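/- Conventions. $E^3_1$, $E^5_2$ have the metrics $\langle\,,\rangle$ of signatures $(+,+,-)$, $(+,+,+,-,-)$; $S^4_2=\{x\in E^5_2:\langle x,x\rangle=1\}$ has the induced neutral metric $h$ with Levi-Civita connection $\nabla$. $E^3_1$ is isometrically identified with the slice $\{x^5=x^1+1\}$ of the light cone of $E^5_2$. A Lorentz surface is a surface with an atlas of paracomplex coordinates $w=u+jv$ ($j^2=1$) and smooth paraholomorphic coordinate changes. Let $\iota:M\to E^3_1$ be a smooth time-like conformal minimal immersion of a Lorentz surface $M$, with induced metric $g^M$ of curvature $K^M$. Let $\gamma$ be its unit normal vector field determined by the orientations of $M$ (where $(X,jX)$ is positive for $X$ space-like) and $E^3_1$; as a map into $E^5_2$ it takes values in $S^4_2$ and is the conformal Gauss map of $\iota$. Let ${\rm Reg}(\iota)=\{K^M\neq0\}$, $F=\gamma|_{{\rm Reg}(\iota)}$ and $E=F^*TS^4_2$, with the induced metric $h$ and $h$-connection $\nabla$; $\hat\nabla$ is the connection induced on $\bigwedge^2E$, and $\bigwedge^2E$ carries the induced metric $\hat h$. Let $w=u+jv$ be a local paracomplex coordinate with $g^M=e^{2\lambda}(du^2-dv^2)$,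 and let $l,m$ be the coefficients of $\gamma$ in $\iota_{uu}$, $\iota_{uv}$. Let $\nu$ be the light-like normal vector field of $F$ with $\langle\nu,\iota\rangle=-1$. On ${\rm Reg}(\iota)$ set $$e_1=\frac{F_u}{\sqrt{|K^M|}\,e^\lambda},\quad e_3=\frac{F_v}{\sqrt{|K^M|}\,e^\lambda}\quad\text{if }K^M<0,\qquad e_1=\frac{F_v}{\sqrt{|K^M|}\,e^\lambda},\quad e_3=\frac{F_u}{\sqrt{|K^M|}\,e^\lambda}\quad\text{if }K^M>0,$$ $$e_2=\tfrac1{\sqrt2}(\nu-\iota),\quad e_4=\tfrac1{\sqrt2}(\nu+\iota),\qquad \tilde l=\frac{l\,e^{2\lambda}}{\sqrt2(l^2-m^2)},\quad \tilde m=\frac{m\,e^{2\lambda}}{\sqrt2(l^2-m^2)}.$$ Then $(e_1,e_2,e_3,e_4)$ is a pseudo-orthonormal frame of $E$ ($e_1,e_2$ space-like, $e_3,e_4$ time-like), and $S^4_2$ is oriented so that it is positive. Let $(e^1,\dots,e^4)$ be the dual frame; via $dF$, $e^1$ and $e^3$ are also regarded as $1$-forms on ${\rm Reg}(\iota)$.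 For $\varepsilon\in\{+,-\}$ the lift $\hat F_\varepsilon$ of $F$ to the time-like twistor space is the section of $\bigwedge^2E$ given by $\frac1{\sqrt2}(f_1\wedge f_3+\varepsilon f_4\wedge f_2)$ for any positive pseudo-orthonormal basis $(f_1,\dots,f_4)$ of a fiber with $f_1=dF(X)$, $f_3=dF(jX)$ for some $X$, and $J_\varepsilon$ is the corresponding $\varepsilon$-paracomplex structure of $E$: $J_\varepsilon f_1=f_3$, $J_\varepsilon f_3=f_1$, $J_\varepsilon f_2=-\varepsilon f_4$, $J_\varepsilon f_4=-\varepsilon f_2$. Theorem. For $\varepsilon\in\{+,-\}$: (1) $\hat\nabla\hat F_\varepsilon$ is fully light-like on ${\rm Reg}(\iota)$: at every point, $\hat\nabla_X\hat F_\varepsilon$ is light-like or zero for every tangent vector $X$, it does not vanish for all $X$, and its values lie in one line. (2) $\hat F_\varepsilon=\frac1{\sqrt2}(e_1\wedge e_3+\varepsilon e_4\wedge e_2)$, $J_\varepsilon e_1=e_3$, $J_\varepsilon e_2=-\varepsilon e_4$, $J_\varepsilon e_3=e_1$, $J_\varepsilon e_4=-\varepsilon e_2$, and with $$\xi_1=e_1-\varepsilon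 e_3,\quad \xi_2=e_2+e_4,\quad \theta^1=e^1+\varepsilon e^3,\quad \theta^2=e^2-e^4,\quad N=\theta^1\otimes\xi_2-\theta^2\otimes\xi_1,$$ one has $\nabla J_\varepsilon=\alpha\otimes N$, where $\alpha=-(\varepsilon\tilde l+\tilde m)\theta^1$ if $K^M<0$, and $\alpha=(\varepsilon\tilde l+\tilde m)\theta^1$ if $K^M>0$. Moreover $N$ is an $\varepsilon$-nilpotent structure with admissible frame $f=(e_1,e_2,\varepsilon e_3,\varepsilon e_4)$, that is, $Nf_1=Nf_3=f_2+\varepsilon f_4$, $Nf_2=-f_1+f_3$, $N(\varepsilon f_4)=f_1-f_3$. -/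

import Mathlib

open scoped ContDiff Manifold Topology

noncomputable section

/-! ### Lorentz surfaces -/

/-- Multiplication by the paracomplex unit `j` (with `j ^ 2 = 1`) on the paracomplex numbers
`u + j v`, written as pairs `(u, v)`. -/
def parJ : (ℝ × ℝ) →L[ℝ] (ℝ × ℝ) :=
  (ContinuousLinearMap.snd ℝ ℝ ℝ).prod (ContinuousLinearMap.fst ℝ ℝ ℝ)

/-- Smooth maps between open sets of the paracomplex plane with paracomplex linear differential. -/
def paraholomorphicPregroupoid : Pregroupoid (ℝ × ℝ) where
  property f s := ContDiffOn ℝ ∞ f s ∧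
    ∀ x ∈ s, ∀ X : ℝ × ℝ, fderiv ℝ f x (parJ X) = parJ (fderiv ℝ f x X)
  comp {f g u v} hf hg hu hv _ := by
    refine ⟨hg.1.comp (hf.1.mono Set.inter_subset_left) (fun x hx => hx.2), ?_⟩
    intro x hx X
    have h1 : DifferentiableAt ℝ f x :=
      ((hf.1.contDiffAt (hu.mem_nhds hx.1)).differentiableAt (by simp))
    have h2 : DifferentiableAt ℝ g (f x) :=
      ((hg.1.contDiffAt (hv.mem_nhds hx.2)).differentiableAt (by simp))
    rw [fderiv_comp x h2 h1]
    simp only [ContinuousLinearMap.comp_apply]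
    rw [hf.2 x hx.1, hg.2 _ hx.2]
  id_mem := ⟨contDiffOn_id, fun x _ X => by simp⟩
  locality {f u} hu H := by
    refine ⟨contDiffOn_of_locally_contDiffOn fun x hx => ?_, fun x hx X => ?_⟩
    · obtain ⟨v, hv, hxv, h⟩ := H x hx
      exact ⟨v, hv, hxv, h.1⟩
    · obtain ⟨v, hv, hxv, h⟩ := H x hx
      exact h.2 x ⟨hx, hxv⟩ X
  congr {f g u} hu hfg hf := by
    refine ⟨hf.1.congr hfg, fun x hx X => ?_⟩
    have : g =ᶠ[𝓝 x] f := Filter.eventuallyEq_of_mem (hu.mem_nhds hx) hfg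
    rw [this.fderiv_eq]
    exact hf.2 x hx X

/-- The groupoid of paraholomorphic local diffeomorphisms. A *Lorentz surface* is a space `M` with
`[ChartedSpace (ℝ × ℝ) M] [HasGroupoid M paraholomorphicGroupoid]`; its local paracomplex
coordinates `w = u + j v` are the elements of `paraholomorphicGroupoid.maximalAtlas M`. -/
def paraholomorphicGroupoid : StructureGroupoid (ℝ × ℝ) :=
  paraholomorphicPregroupoid.groupoid

/-! ### The spaces `E^3_1`, `E^5_2` and `S^4_2` -/

abbrev E31 := Fin 3 → ℝ

abbrev E52 := Fin 5 → ℝ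

/-- The metric of `E^3_1`. -/
def ip3 (x y : E31) : ℝ := x 0 * y 0 + x 1 * y 1 - x 2 * y 2

/-- The metric of `E^5_2`. Its restriction to `x^⊥ = T_x S^4_2` is the neutral metric `h` of
`S^4_2 = {x | ip5 x x = 1}`. -/
def ip5 (x y : E52) : ℝ := x 0 * y 0 + x 1 * y 1 + x 2 * y 2 - x 3 * y 3 - x 4 * y 4

/-- The isometric identification of `E^3_1` with the slice `x^5 = x^1 + 1` of the light cone of
`E^5_2`. -/
def coneEmb (y : E31) : E52 :=
  ![(ip3 y y - 1) / 2, y 0, y 1, y 2, (ip3 y y + 1) / 2]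

section Surface

variable {M : Type*} [TopologicalSpace M] [ChartedSpace (ℝ × ℝ) M]
variable {V : Type*} [NormedAddCommGroup V] [NormedSpace ℝ V]

/-- The differential at `p` of a vector-valued map on `M`. A tangent vector at `p` is an element
of `TangentSpace 𝓘(ℝ, ℝ × ℝ) p`, which is `ℝ × ℝ`, and `parJ` acts on it as the paracomplex
structure of `M` if `M` is a Lorentz surface. -/
def dAt (f : M → V) (p : M) : (ℝ × ℝ) →L[ℝ] V :=
  mfderiv 𝓘(ℝ, ℝ × ℝ) 𝓘(ℝ, V) f p

/-- Partial derivatives on the coordinate plane: `0` for `∂/∂u`, `1` for `∂/∂v`. -/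
def pd (i : Fin 2) (f : ℝ × ℝ → V) (w : ℝ × ℝ) : V :=
  fderiv ℝ f w ((![(1, 0), (0, 1)] : Fin 2 → ℝ × ℝ) i)

/-- The partial derivative of `f : M → V` at `p` in the local coordinates `φ`. -/
def chartD (φ : OpenPartialHomeomorph M (ℝ × ℝ)) (i : Fin 2) (f : M → V) (p : M) : V :=
  pd i (f ∘ φ.symm) (φ p)

/-- The second partial derivative of `f : M → V` at `p` in the local coordinates `φ`. -/
def chartD2 (φ : OpenPartialHomeomorph M (ℝ × ℝ)) (i j : Fin 2) (f : M → V) (p : M) : V :=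
  pd i (pd j (f ∘ φ.symm)) (φ p)

/-! ### Curvature of a metric on an open set of the plane -/

/-- The Christoffel symbols `Γ^k_{ij}` of the metric with coefficients `g i j`. -/
def christoffel (g : Fin 2 → Fin 2 → ℝ × ℝ → ℝ) (k i j : Fin 2) (w : ℝ × ℝ) : ℝ :=
  1 / 2 * ∑ l, (Matrix.of fun a b => g a b w)⁻¹ k l *
    (pd i (g j l) w + pd j (g i l) w - pd l (g i j) w)

/-- The coefficients `R^l_{kij}` with `R(∂_i, ∂_j) ∂_k = R^l_{kij} ∂_l`. -/
def riemann (g : Fin 2 → Fin 2 → ℝ × ℝ → ℝ) (l k i j : Fin 2) (w : ℝ × ℝ) : ℝ :=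
  pd i (christoffel g l j k) w - pd j (christoffel g l i k) w +
    ∑ m, (christoffel g l i m w * christoffel g m j k w -
      christoffel g l j m w * christoffel g m i k w)

/-- The curvature `g(R(∂_0, ∂_1) ∂_1, ∂_0) / (g_00 g_11 - g_01 ^ 2)`. -/
def curvature (g : Fin 2 → Fin 2 → ℝ × ℝ → ℝ) (w : ℝ × ℝ) : ℝ :=
  (∑ l, riemann g l 1 0 1 w * g l 0 w) / (g 0 0 w * g 1 1 w - g 0 1 w ^ 2)

/-! ### Time-like minimal surfaces in `E^3_1` -/

/-- A smooth immersion whose induced metric is Lorentzian and which is conformal, i.e. the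
paracomplex structure of `M` is an anti-isometry for the induced metric. -/
structure IsTimelikeConformalImmersion (ι : M → E31) : Prop where
  smooth : ContMDiff 𝓘(ℝ, ℝ × ℝ) 𝓘(ℝ, E31) ∞ ι
  immersion : ∀ p, Function.Injective (dAt ι p)
  exists_spacelike : ∀ p, ∃ X, 0 < ip3 (dAt ι p X) (dAt ι p X)
  exists_timelike : ∀ p, ∃ X, ip3 (dAt ι p X) (dAt ι p X) < 0
  conformal : ∀ p X, ip3 (dAt ι p (parJ X)) (dAt ι p (parJ X)) = -ip3 (dAt ι p X) (dAt ι p X)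

/-- The coefficients, in the local coordinates `φ`, of the metric `g^M` induced by `ι`. -/
def inducedMetric (ι : M → E31) (φ : OpenPartialHomeomorph M (ℝ × ℝ)) (i j : Fin 2)
    (w : ℝ × ℝ) : ℝ :=
  ip3 (pd i (ι ∘ φ.symm) w) (pd j (ι ∘ φ.symm) w)

/-- The curvature `K^M` of the induced metric. -/
def gaussCurv (ι : M → E31) (p : M) : ℝ :=
  curvature (inducedMetric ι (chartAt (ℝ × ℝ) p)) (chartAt (ℝ × ℝ) p p)

/-- The set of points where `K^M` does not vanish. -/
def Reg (ι : M → E31) : Set M := {p | gaussCurv ι p ≠ 0}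

/-- `n` is the unit normal vector field of `ι` determined by the orientations: `(X, j X)` with
`X` space-like is a positive basis of the tangent plane, and `o = 1` (respectively `o = -1`) if
`E^3_1` has the standard (respectively the opposite) orientation. -/
structure IsUnitNormal (o : ℝ) (ι n : M → E31) : Prop where
  unit : ∀ p, ip3 (n p) (n p) = 1
  normal : ∀ p X, ip3 (n p) (dAt ι p X) = 0
  oriented : ∀ p X, 0 < ip3 (dAt ι p X) (dAt ι p X) →
    0 < o * (Matrix.of ![dAt ι p X, dAt ι p (parJ X), n p]).det

/-- The coefficients of the second fundamental form of `ι` with respect to `n`. -/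
def secondFF (ι n : M → E31) (φ : OpenPartialHomeomorph M (ℝ × ℝ)) (i j : Fin 2) (p : M) : ℝ :=
  ip3 (chartD2 φ i j ι p) (n p)

/-- The mean curvature, i.e. half of the trace of the second fundamental form with respect to the
induced metric. -/
def meanCurv (ι n : M → E31) (φ : OpenPartialHomeomorph M (ℝ × ℝ)) (p : M) : ℝ :=
  (inducedMetric ι φ 1 1 (φ p) * secondFF ι n φ 0 0 p
    - 2 * inducedMetric ι φ 0 1 (φ p) * secondFF ι n φ 0 1 p
    + inducedMetric ι φ 0 0 (φ p) * secondFF ι n φ 1 1 p) /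
  (2 * (inducedMetric ι φ 0 0 (φ p) * inducedMetric ι φ 1 1 (φ p)
    - inducedMetric ι φ 0 1 (φ p) ^ 2))

def IsMinimal (ι n : M → E31) : Prop :=
  ∀ φ ∈ paraholomorphicGroupoid.maximalAtlas M, ∀ p ∈ φ.source, meanCurv ι n φ p = 0

/-- The conformal Gauss map: the unit normal vector field of the minimal surface, as a
vector-valued function in `E^5_2` (with values in `S^4_2`) under the identification `coneEmb`. -/
def conformalGaussMap (ι n : M → E31) (p : M) : E52 :=
  fderiv ℝ coneEmb (ι p) (n p)

/-! ### The pull-back bundle `E = F^* T S^4_2` and its induced bundles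

The fiber `E_p` is the orthogonal complement of `F p` in `E^5_2`. -/

/-- The orthogonal projection of `E^5_2` onto `T_x S^4_2`, for `ip5 x x = 1`. -/
def tangentProj (x y : E52) : E52 := y - ip5 y x • x

/-- The connection `∇` of `E` given by the Levi-Civita connection of `S^4_2`. -/
def nabla (F : M → E52) (Y : M → E52) (p : M) (X : ℝ × ℝ) : E52 :=
  tangentProj (F p) (dAt Y p X)

/-- Bivectors of `E^5_2`, as skew-symmetric contravariant 2-tensors. -/
abbrev Biv := Fin 5 → Fin 5 → ℝ

/-- `a ∧ b = a ⊗ b - b ⊗ a`. -/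
def wedge (a b : E52) : Biv := fun i j => a i * b j - b i * a j

/-- The diagonal coefficients of the metric of `E^5_2`. -/
def sgn5 : Fin 5 → ℝ := ![1, 1, 1, -1, -1]

/-- The induced metric of bivectors; on decomposable ones
`⟨a ∧ b, c ∧ d⟩ = ⟨a, c⟩ ⟨b, d⟩ - ⟨a, d⟩ ⟨b, c⟩`. -/
def bivIp (A B : Biv) : ℝ := 1 / 2 * ∑ i, ∑ j, sgn5 i * sgn5 j * A i j * B i j

/-- The map induced on 2-tensors by the projection `tangentProj x`. -/
def bivProj (x : E52) (A : Biv) : Biv := fun i j =>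
  ∑ k, ∑ l, tangentProj x (Pi.single k 1) i * tangentProj x (Pi.single l 1) j * A k l

/-- The connection `∇^` of `⋀² E` induced by `∇`, so that `∇^(a ∧ b) = ∇a ∧ b + a ∧ ∇b` for
sections `a`, `b` of `E`. -/
def nablaBiv (F : M → E52) (Ω : M → Biv) (p : M) (X : ℝ × ℝ) : Biv :=
  bivProj (F p) (dAt Ω p X)

/-- At `p` the covariant derivative of the section `Ω` of `⋀² E` is light-like or zero in every
direction, it is not zero, and its values lie in one line. -/
structure IsFullyLightlikeAt (F : M → E52) (Ω : M → Biv) (p : M) : Prop where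
  null : ∀ X, bivIp (nablaBiv F Ω p X) (nablaBiv F Ω p X) = 0
  ne_zero : ∃ X, nablaBiv F Ω p X ≠ 0
  line : ∃ θ : Biv, ∀ X, ∃ c : ℝ, nablaBiv F Ω p X = c • θ

/-- `(∇_X J) Y = ∇_X (J Y) - J (∇_X Y)` equals `A X (Y p)` for all tangent vectors `X` at `p` and
all local sections `Y` of `E`. Here `J` is a section of `End E`; only the action of `J q` on the
fiber `E_q` matters. -/
def HasCovDerivEndAt (F : M → E52) (J : M → E52 →ₗ[ℝ] E52) (p : M)
    (A : ℝ × ℝ → E52 → E52) : Prop :=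
  ∀ Y : M → E52, ContMDiffAt 𝓘(ℝ, ℝ × ℝ) 𝓘(ℝ, E52) ∞ Y p →
    (∀ᶠ q in 𝓝 p, ip5 (Y q) (F q) = 0) →
    ∀ X, nabla F (fun q => J q (Y q)) p X - J p (nabla F Y p X) = A X (Y p)

/-! ### Frames -/

/-- `e` (indexed from `0`) is a pseudo-orthonormal basis of `T_x S^4_2`, with `e 0`, `e 1`
space-like and `e 2`, `e 3` time-like, which is positive for the orientation of `S^4_2` that
belongs to the orientation `o` of `E^3_1`. -/
structure IsOrientedFrame (o : ℝ) (x : E52) (e : Fin 4 → E52) : Prop where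
  tangent : ∀ i, ip5 (e i) x = 0
  gram : ∀ i j, ip5 (e i) (e j) =
    if i = j then (![1, 1, -1, -1] : Fin 4 → ℝ) i else 0
  oriented : 0 < -o * (Matrix.of ![e 0, e 1, e 2, e 3, x]).det

/-- `Ω_{ε,2} = (1/√2) (e_1 ∧ e_3 + ε e_4 ∧ e_2)`. -/
def Omega2 (ε : ℝ) (e : Fin 4 → E52) : Biv :=
  (1 / √2) • (wedge (e 0) (e 2) + ε • wedge (e 3) (e 1))

/-- `e` is adapted to `F` at `p`: `e_1`, `e_3` are tangent to `F` and `e_3 = dF (j X)` if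
`e_1 = dF X`. -/
def IsAdaptedFrame (o : ℝ) (F : M → E52) (p : M) (e : Fin 4 → E52) : Prop :=
  IsOrientedFrame o (F p) e ∧ ∃ X, e 0 = dAt F p X ∧ e 2 = dAt F p (parJ X)

/-- `Ω` is the lift of `F` to the time-like twistor space `U_-(⋀²_ε E)` over the set `S`. -/
def IsTwistorLift (o : ℝ) (F : M → E52) (S : Set M) (ε : ℝ) (Ω : M → Biv) : Prop :=
  ∀ p ∈ S, ∃ e, IsAdaptedFrame o F p e ∧ Ω p = Omega2 ε e

/-- `e` is an admissible frame of the `ε`-paracomplex structure `J` at one point: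
`J e_1 = e_3`, `J e_2 = -ε e_4`, `J e_3 = e_1`, `J e_4 = -ε e_2`. -/
def IsAdmissiblePara (ε : ℝ) (e : Fin 4 → E52) (J : E52 →ₗ[ℝ] E52) : Prop :=
  J (e 0) = e 2 ∧ J (e 1) = -ε • e 3 ∧ J (e 2) = e 0 ∧ J (e 3) = -ε • e 1

/-- `f` is an admissible frame of the `ε`-nilpotent structure `N` at one point: in the basis
`(f_1, f_2, f_3, ε f_4)` the matrix of `N` has the columns `(0,1,0,1)`, `(-1,0,1,0)`, `(0,1,0,1)`,
`(1,0,-1,0)`. -/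
def IsAdmissibleNil (ε : ℝ) (f : Fin 4 → E52) (N : E52 →ₗ[ℝ] E52) : Prop :=
  N (f 0) = f 1 + ε • f 3 ∧ N (f 1) = -f 0 + f 2 ∧
    N (f 2) = f 1 + ε • f 3 ∧ N (ε • f 3) = f 0 - f 2

/-- `J` is the `ε`-paracomplex structure of `E` (over `S`) corresponding to the section `Ω` of
`U_-(⋀²_ε E)`. -/
def IsCorrespondingPara (o : ℝ) (F : M → E52) (S : Set M) (ε : ℝ) (Ω : M → Biv)
    (J : M → E52 →ₗ[ℝ] E52) : Prop :=
  ∀ p ∈ S, ∃ e, IsOrientedFrame o (F p) e ∧ Ω p = Omega2 ε e ∧ IsAdmissiblePara ε e (J p)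

/-! ### The explicit frame and the explicit covariant derivative -/

/-- A local paracomplex coordinate `w = u + j v` in which `g^M = e^{2λ} (du² - dv²)`, that is, in which
`∂/∂u` is space-like for `g^M`. -/
def IsAdaptedChart (ι : M → E31) (φ : OpenPartialHomeomorph M (ℝ × ℝ)) : Prop :=
  φ ∈ paraholomorphicGroupoid.maximalAtlas M ∧
    ∀ p ∈ φ.source, 0 < inducedMetric ι φ 0 0 (φ p)

/-- `λ` with `g^M = e^{2λ} (du² - dv²)`. -/
def confFactor (ι : M → E31) (φ : OpenPartialHomeomorph M (ℝ × ℝ)) (p : M) : ℝ :=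
  1 / 2 * Real.log (inducedMetric ι φ 0 0 (φ p))

/-- `l e^{2λ} / (√2 (l² - m²))`, where `l`, `m` are the coefficients of `n` in `ι_uu`, `ι_uv`. -/
def lTilde (ι n : M → E31) (φ : OpenPartialHomeomorph M (ℝ × ℝ)) (p : M) : ℝ :=
  secondFF ι n φ 0 0 p * Real.exp (2 * confFactor ι φ p) /
    (√2 * (secondFF ι n φ 0 0 p ^ 2 - secondFF ι n φ 0 1 p ^ 2))

/-- `m e^{2λ} / (√2 (l² - m²))`, where `l`, `m` are the coefficients of `n` in `ι_uu`, `ι_uv`. -/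
def mTilde (ι n : M → E31) (φ : OpenPartialHomeomorph M (ℝ × ℝ)) (p : M) : ℝ :=
  secondFF ι n φ 0 1 p * Real.exp (2 * confFactor ι φ p) /
    (√2 * (secondFF ι n φ 0 0 p ^ 2 - secondFF ι n φ 0 1 p ^ 2))

/-- `ν` is a light-like normal vector field of the conformal Gauss map `F` on `Reg ι` with
`⟨ν, ι⟩ = -1`. -/
structure IsDualNormal (ι n : M → E31) (ν : M → E52) : Prop where
  null : ∀ p ∈ Reg ι, ip5 (ν p) (ν p) = 0
  tangent : ∀ p ∈ Reg ι, ip5 (ν p) (conformalGaussMap ι n p) = 0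
  normal : ∀ p ∈ Reg ι, ∀ X, ip5 (ν p) (dAt (conformalGaussMap ι n) p X) = 0
  dual : ∀ p ∈ Reg ι, ip5 (ν p) (coneEmb (ι p)) = -1

/-- The frame `e_1, …, e_4` at `p`: `e_1`, `e_3` are `F_u`, `F_v` (in this order if `K^M < 0`,
in the opposite order if `K^M > 0`) divided by `√|K^M| e^λ`, and `e_2 = (ν - ι)/√2`,
`e_4 = (ν + ι)/√2`. -/
def gaussFrame (ι n : M → E31) (ν : M → E52) (φ : OpenPartialHomeomorph M (ℝ × ℝ)) (p : M) :
    Fin 4 → E52 :=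
  let r := 1 / (√|gaussCurv ι p| * Real.exp (confFactor ι φ p))
  let a : E52 := r • chartD φ 0 (conformalGaussMap ι n) p
  let b : E52 := r • chartD φ 1 (conformalGaussMap ι n) p
  ![if gaussCurv ι p < 0 then a else b,
    (1 / √2) • (ν p - coneEmb (ι p)),
    if gaussCurv ι p < 0 then b else a,
    (1 / √2) • (ν p + coneEmb (ι p))]

end Surface

/-- `y ↦ ⟨x, y⟩` as a linear form. -/
def ipForm (x : E52) : E52 →ₗ[ℝ] ℝ where
  toFun y := ip5 x y
  map_add' y z := by simp [ip5]; ring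
  map_smul' c y := by simp [ip5]; ring

/-- The dual frame `e^1, …, e^4` of a pseudo-orthonormal frame. -/
def coframe (e : Fin 4 → E52) (i : Fin 4) : E52 →ₗ[ℝ] ℝ :=
  (![1, 1, -1, -1] : Fin 4 → ℝ) i • ipForm (e i)

def xi1 (ε : ℝ) (e : Fin 4 → E52) : E52 := e 0 - ε • e 2

def xi2 (e : Fin 4 → E52) : E52 := e 1 + e 3

def theta1 (ε : ℝ) (e : Fin 4 → E52) : E52 →ₗ[ℝ] ℝ := coframe e 0 + ε • coframe e 2

def theta2 (e : Fin 4 → E52) : E52 →ₗ[ℝ] ℝ := coframe e 1 - coframe e 3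

/-- `N = θ^1 ⊗ ξ_2 - θ^2 ⊗ ξ_1`. -/
def nilN (ε : ℝ) (e : Fin 4 → E52) : E52 →ₗ[ℝ] E52 :=
  (theta1 ε e).smulRight (xi2 e) - (theta2 e).smulRight (xi1 ε e)

end

/-! In the light-cone model the point `y` of $E^3_1$ becomes the null vector `coneEmb y`, tangent
vectors are embedded isometrically by `coneD y`, and the constant null vector `coneK` is orthogonal
to all of them with $\langle$`coneK`, `coneEmb y`$\rangle=-1$. The conformal Gauss map is $F=$
`coneD ι n`; since $n$ is orthogonal to $d\iota$, its differential is `coneD ι` applied to $dn$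
(`IsMinimalNear.fderiv_gauss`). The Weingarten map of a minimal surface is trace free, so $dn\circ
j=-j\circ dn$ on tangent planes, and its square is $-K^M$ (`IsMinimalNear.ip3_fderiv_n`,
`IsMinimalNear.curvature_eq`). Hence, where $K^M\neq0$, $F$ is a conformal immersion with the same
tangent planes as $\iota$, its normal plane is spanned by `coneK` and `coneEmb ι`, and $\nu$ is the
constant `coneK` (`IsMinimalSurface.dualNormal_eq`).

The tangential half of the lift is dual to $n$ in $E^3_1$ and the normal half is $\iota\wedge\nu$,
so the lift is the explicit bivector `gaussTwistor`, whatever adapted frame is used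
(`IsOrientedFrame.Omega2_eq`). In its derivative the terms with $dn$ contain the factor $F$ and are
killed by the projection. As $\nu$ is constant and the cross product with $n$ is $o\,j$ on tangent
planes, what remains is $\frac1{\sqrt2}\bigl((\varepsilon+j)\,d\iota(X)\bigr)\wedge\nu$. The element
$\varepsilon+j$ is a zero divisor with $(\varepsilon+j)j=\varepsilon(\varepsilon+j)$, so these
values lie in one line, and they are null because $\nu$ is null and orthogonal to the other factor
(`IsMinimalNear.bivProj_fderiv_gaussTwistor`).

On the fibers $J_\varepsilon$ is $-\sqrt2$ times contraction with the lift, hence $\nabla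
J_\varepsilon$ is $-\sqrt2$ times contraction with $\hat\nabla\hat F_\varepsilon$
(`covDeriv_end_eq`). Likewise $N$ is minus contraction with $\xi_1\wedge\xi_2$, where
$\xi_2=\sqrt2\,\nu$ and $\xi_1$ spans the null line of $(\varepsilon+j)\,d\iota$. The form $\alpha$
is the ratio of these two bivectors, computed from the Weingarten equations
(`IsMinimalNear.smul_lightlike_eq`, `IsMinimalSurface.smul_wedge_eq`). -/

noncomputable section

/-! ### Linear algebra of `E^3_1` and `E^5_2` -/

/-- The differential of `coneEmb` at `y`. -/
def coneD (y v : E31) : E52 := ![ip3 y v, v 0, v 1, v 2, ip3 y v]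

/-- The constant light-like vector that is orthogonal to the differential of `coneEmb`. -/
def coneK : E52 := ![1, 0, 0, 0, 1]

/-- The cross product of `E^3_1`. -/
def lcross (a b : E31) : E31 :=
  ![a 1 * b 2 - a 2 * b 1, a 2 * b 0 - a 0 * b 2, -(a 0 * b 1 - a 1 * b 0)]

/-- The image under `coneD y` of the bivector of `E^3_1` that is dual to `v`. -/
def coneStar (y v : E31) : Biv :=
  v 0 • wedge (coneD y ![0, 1, 0]) (coneD y ![0, 0, 1]) +
    v 1 • wedge (coneD y ![0, 0, 1]) (coneD y ![1, 0, 0]) -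
    v 2 • wedge (coneD y ![1, 0, 0]) (coneD y ![0, 1, 0])

/-- Contraction of a bivector with a vector. -/
def contr (A : Biv) (y : E52) : E52 := fun i => ∑ j, A i j * (sgn5 j * y j)

/-! ### Conformal frames and the cross product in $E^3_1$ -/

section E31

lemma ip3_comm (x y : E31) : ip3 x y = ip3 y x := by simp only [ip3]; ring
lemma ip3_add_left (x y z : E31) : ip3 (x + y) z = ip3 x z + ip3 y z := by
  simp only [ip3, Pi.add_apply]; ring
lemma ip3_add_right (x y z : E31) : ip3 x (y + z) = ip3 x y + ip3 x z := by
  simp only [ip3, Pi.add_apply]; ring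
lemma ip3_smul_left (c : ℝ) (x y : E31) : ip3 (c • x) y = c * ip3 x y := by
  simp only [ip3, Pi.smul_apply, smul_eq_mul]; ring
lemma ip3_smul_right (c : ℝ) (x y : E31) : ip3 x (c • y) = c * ip3 x y := by
  simp only [ip3, Pi.smul_apply, smul_eq_mul]; ring
lemma ip3_lcross (a b c : E31) : ip3 (lcross a b) c = (Matrix.of ![a, b, c]).det := by
  simp [Matrix.det_fin_three, ip3, lcross]; ring

lemma lcross_add_left (a b c : E31) : lcross (a + b) c = lcross a c + lcross b c := by
  ext i; fin_cases i <;> simp [lcross] <;> ring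
lemma lcross_smul_left (r : ℝ) (a b : E31) : lcross (r • a) b = r • lcross a b := by
  ext i; fin_cases i <;> simp [lcross] <;> ring
lemma lcross_add_right (a b c : E31) : lcross a (b + c) = lcross a b + lcross a c := by
  ext i; fin_cases i <;> simp [lcross] <;> ring
lemma lcross_smul_right (r : ℝ) (a b : E31) : lcross a (r • b) = r • lcross a b := by
  ext i; fin_cases i <;> simp [lcross] <;> ring
lemma lcross_self (a : E31) : lcross a a = 0 := by
  ext i; fin_cases i <;> simp [lcross] <;> ring
lemma lcross_comm (a b : E31) : lcross a b = -lcross b a := by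
  ext i; fin_cases i <;> simp [lcross] <;> ring

/-- `a`, `b` are the coordinate vectors of a conformal time-like immersion and `n` is the unit
normal vector, with `o` the orientation of `E^3_1`. -/
structure IsConfFrame (o A : ℝ) (a b n : E31) : Prop where
  ho : o ^ 2 = 1
  hA : A ≠ 0
  aa : ip3 a a = A
  bb : ip3 b b = -A
  ab : ip3 a b = 0
  nn : ip3 n n = 1
  na : ip3 n a = 0
  nb : ip3 n b = 0
  det : (Matrix.of ![a, b, n]).det = o * A

variable {o A : ℝ} {a b n : E31}

/-- The determinant $oA$ is nonzero, so $a,b,n$ form a basis and the metric is nondegenerate. -/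
lemma IsConfFrame.ext_ip (h : IsConfFrame o A a b n) {v w : E31} (ha : ip3 v a = ip3 w a)
    (hb : ip3 v b = ip3 w b) (hn : ip3 v n = ip3 w n) : v = w := by
  have hdet : (Matrix.of ![a, b, n]).det ≠ 0 := by
    rw [h.det]
    refine mul_ne_zero (fun h0 => ?_) h.hA
    have := h.ho
    simp [h0] at this
  -- The sign of the last entry turns the Euclidean product of rows into the Lorentzian one.
  have key : (Matrix.of ![a, b, n]).mulVec ![v 0 - w 0, v 1 - w 1, -(v 2 - w 2)] = 0 := by
    simp only [ip3] at ha hb hn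
    ext i
    fin_cases i <;> simp [Matrix.mulVec, dotProduct, Fin.sum_univ_three] <;> linarith
  have := Matrix.eq_zero_of_mulVec_eq_zero hdet key
  have h0 := congrFun this 0
  have h1 := congrFun this 1
  have h2 := congrFun this 2
  simp at h0 h1 h2
  ext i
  fin_cases i <;> simp <;> linarith

lemma IsConfFrame.expand (h : IsConfFrame o A a b n) (v : E31) :
    v = (ip3 v a / A) • a - (ip3 v b / A) • b + ip3 v n • n := by
  have hA := h.hA
  rw [sub_eq_add_neg, ← neg_smul]
  refine h.ext_ip ?_ ?_ ?_ <;>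
    simp only [ip3_add_left, ip3_smul_left, h.aa, h.ab, h.na, h.bb, h.nb, h.nn,
      ip3_comm b a, ip3_comm a n, ip3_comm b n] <;> field_simp <;> ring

lemma IsConfFrame.lcross_ab (h : IsConfFrame o A a b n) : lcross a b = (o * A) • n := by
  refine h.ext_ip ?_ ?_ ?_ <;>
    simp only [ip3_lcross, ip3_smul_left, h.na, h.nb, h.nn, h.det] <;>
    simp [Matrix.det_fin_three] <;> ring

/-- With `lcross_bn`: on the tangent plane, the cross product with $n$ is $o$ times the paracomplex
structure $a\leftrightarrow b$. This is how $j$ enters the derivative of the twistor lift. -/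
lemma IsConfFrame.lcross_an (h : IsConfFrame o A a b n) : lcross a n = o • b := by
  have hd := h.det
  refine h.ext_ip ?_ ?_ ?_ <;>
    simp only [ip3_lcross, ip3_smul_left, h.bb, ip3_comm b a, h.ab, ip3_comm b n, h.nb]
  · simp [Matrix.det_fin_three]; ring
  · simp only [Matrix.det_fin_three, Matrix.of_apply, Matrix.cons_val] at hd ⊢; linarith
  · simp [Matrix.det_fin_three]; ring

lemma IsConfFrame.lcross_bn (h : IsConfFrame o A a b n) : lcross b n = o • a := by
  have hd := h.det
  refine h.ext_ip ?_ ?_ ?_ <;>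
    simp only [ip3_lcross, ip3_smul_left, h.aa, h.ab, ip3_comm a n, h.na]
  · simp only [Matrix.det_fin_three, Matrix.of_apply, Matrix.cons_val] at hd ⊢; linarith
  · simp [Matrix.det_fin_three]; ring
  · simp [Matrix.det_fin_three]; ring

end E31

/-! ### The light-cone model and bivectors of $E^5_2$ -/

section E52

lemma ip5_comm (x y : E52) : ip5 x y = ip5 y x := by simp only [ip5]; ring
lemma ip5_add_left (x y z : E52) : ip5 (x + y) z = ip5 x z + ip5 y z := by
  simp only [ip5, Pi.add_apply]; ring
lemma ip5_add_right (x y z : E52) : ip5 x (y + z) = ip5 x y + ip5 x z := by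
  simp only [ip5, Pi.add_apply]; ring
lemma ip5_sub_left (x y z : E52) : ip5 (x - y) z = ip5 x z - ip5 y z := by
  simp only [ip5, Pi.sub_apply]; ring
lemma ip5_sub_right (x y z : E52) : ip5 x (y - z) = ip5 x y - ip5 x z := by
  simp only [ip5, Pi.sub_apply]; ring
lemma ip5_smul_left (c : ℝ) (x y : E52) : ip5 (c • x) y = c * ip5 x y := by
  simp only [ip5, Pi.smul_apply, smul_eq_mul]; ring
lemma ip5_smul_right (c : ℝ) (x y : E52) : ip5 x (c • y) = c * ip5 x y := by
  simp only [ip5, Pi.smul_apply, smul_eq_mul]; ring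

lemma coneD_add (y u v : E31) : coneD y (u + v) = coneD y u + coneD y v := by
  ext i; fin_cases i <;> simp [coneD, ip3_add_right]
lemma coneD_smul (c : ℝ) (y v : E31) : coneD y (c • v) = c • coneD y v := by
  ext i; fin_cases i <;> simp [coneD, ip3_smul_right]
lemma ip5_coneD_coneD (y u v : E31) : ip5 (coneD y u) (coneD y v) = ip3 u v := by
  simp [ip5, coneD, ip3]; ring
lemma ip5_coneD_coneEmb (y u : E31) : ip5 (coneD y u) (coneEmb y) = 0 := by
  simp [ip5, coneD, coneEmb, ip3]; ring
lemma ip5_coneD_coneK (y u : E31) : ip5 (coneD y u) coneK = 0 := by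
  simp [ip5, coneD, coneK]
lemma ip5_coneEmb_coneEmb (y : E31) : ip5 (coneEmb y) (coneEmb y) = 0 := by
  simp [ip5, coneEmb, ip3]; ring
lemma ip5_coneK_coneK : ip5 coneK coneK = 0 := by simp [ip5, coneK]
lemma ip5_coneK_coneEmb (y : E31) : ip5 coneK (coneEmb y) = -1 := by
  simp [ip5, coneEmb, coneK]; ring

lemma ip5_coneEmb_coneD (y u : E31) : ip5 (coneEmb y) (coneD y u) = 0 := by
  rw [ip5_comm, ip5_coneD_coneEmb]
lemma ip5_coneK_coneD (y u : E31) : ip5 coneK (coneD y u) = 0 := by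
  rw [ip5_comm, ip5_coneD_coneK]
lemma ip5_coneEmb_coneK (y : E31) : ip5 (coneEmb y) coneK = -1 := by
  rw [ip5_comm, ip5_coneK_coneEmb]

/-- The normal plane of the differential of the embedding of `E^3_1` is spanned by `coneK` and the
position vector. -/
lemma eq_of_orthogonal_coneD {y : E31} {v : E52} (h : ∀ u, ip5 v (coneD y u) = 0) :
    v = (-ip5 v (coneEmb y)) • coneK + (-ip5 v coneK) • coneEmb y := by
  have h0 := h ![1, 0, 0]
  have h1 := h ![0, 1, 0]
  have h2 := h ![0, 0, 1]
  simp [ip5, coneD, ip3] at h0 h1 h2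
  have h0' : v 1 = -(v 0 - v 4) * y 0 := by linarith
  have h1' : v 2 = -(v 0 - v 4) * y 1 := by linarith
  have h2' : v 3 = -(v 0 - v 4) * y 2 := by linarith
  ext i
  fin_cases i <;> simp [ip5, coneK, coneEmb, ip3, h0', h1', h2'] <;> ring

/-- The span of `coneK` and `coneEmb y` is complementary to the image of `coneD y`, so the
determinant splits into a factor from each. It reduces orientations of $S^4_2$ to orientations of
$E^3_1$. -/
lemma det_coneD (y v w n : E31) (α β γ δ : ℝ) :
    (Matrix.of ![coneD y v, α • coneK + β • coneEmb y, coneD y w, γ • coneK + δ • coneEmb y,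
      coneD y n]).det = (α * δ - β * γ) * (Matrix.of ![v, w, n]).det := by
  simp [Matrix.det_succ_row_zero, Fin.sum_univ_succ, Fin.succAbove, coneD, coneK, coneEmb, ip3]
  ring

lemma wedge_add_left (a b c : E52) : wedge (a + b) c = wedge a c + wedge b c := by
  ext i j; simp only [wedge, Pi.add_apply]; ring
lemma wedge_add_right (a b c : E52) : wedge a (b + c) = wedge a b + wedge a c := by
  ext i j; simp only [wedge, Pi.add_apply]; ring
lemma wedge_smul_left (r : ℝ) (a b : E52) : wedge (r • a) b = r • wedge a b := by
  ext i j; simp only [wedge, Pi.smul_apply, smul_eq_mul]; ring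
lemma wedge_smul_right (r : ℝ) (a b : E52) : wedge a (r • b) = r • wedge a b := by
  ext i j; simp only [wedge, Pi.smul_apply, smul_eq_mul]; ring
lemma wedge_self (a : E52) : wedge a a = 0 := by
  ext i j; simp only [wedge, Pi.zero_apply]; ring
lemma wedge_comm (a b : E52) : wedge a b = -wedge b a := by
  ext i j; simp only [wedge, Pi.neg_apply]; ring

/-- Every bivector of a 3-space is dual to a vector. Consequently the tangential part of a twistor
lift depends only on the cross product of its two factors, a multiple of $n$. -/
lemma wedge_coneD_coneD (y u v : E31) :
    wedge (coneD y u) (coneD y v) = coneStar y (lcross u v) := by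
  ext i j
  fin_cases i <;> fin_cases j <;> simp [wedge, coneD, coneStar, lcross, ip3] <;> ring

lemma coneStar_add (y u v : E31) : coneStar y (u + v) = coneStar y u + coneStar y v := by
  simp only [coneStar, Pi.add_apply]; module
lemma coneStar_smul (c : ℝ) (y v : E31) : coneStar y (c • v) = c • coneStar y v := by
  simp only [coneStar, Pi.smul_apply, smul_eq_mul]; module

lemma bivIp_wedge_self (a b : E52) :
    bivIp (wedge a b) (wedge a b) = ip5 a a * ip5 b b - ip5 a b ^ 2 := by
  simp [bivIp, wedge, ip5, sgn5, Fin.sum_univ_five]; ring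

lemma bivIp_smul_smul (c : ℝ) (A B : Biv) : bivIp (c • A) (c • B) = c ^ 2 * bivIp A B := by
  simp only [bivIp, Pi.smul_apply, smul_eq_mul, Finset.mul_sum]
  refine Finset.sum_congr rfl fun i _ => Finset.sum_congr rfl fun j _ => ?_
  ring

/-- The matrix form of the projection, as used in the definition of `bivProj`. -/
lemma tangentProj_eq_sum (x y : E52) (i : Fin 5) :
    tangentProj x y i = ∑ k, tangentProj x (Pi.single k 1) i * y k := by
  fin_cases i <;> simp [tangentProj, ip5, Fin.sum_univ_five, Pi.single_apply] <;> ring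

lemma bivProj_add (x : E52) (A B : Biv) : bivProj x (A + B) = bivProj x A + bivProj x B := by
  ext i j
  simp only [bivProj, Pi.add_apply, mul_add, Finset.sum_add_distrib]
lemma bivProj_smul (x : E52) (c : ℝ) (A : Biv) : bivProj x (c • A) = c • bivProj x A := by
  ext i j
  simp only [bivProj, Pi.smul_apply, smul_eq_mul, Finset.mul_sum]
  refine Finset.sum_congr rfl fun k _ => Finset.sum_congr rfl fun l _ => ?_
  ring

lemma bivProj_wedge (x a b : E52) :
    bivProj x (wedge a b) = wedge (tangentProj x a) (tangentProj x b) := by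
  ext i j
  simp only [bivProj, wedge]
  rw [tangentProj_eq_sum x a i, tangentProj_eq_sum x b j, tangentProj_eq_sum x b i,
    tangentProj_eq_sum x a j, Finset.sum_mul_sum, Finset.sum_mul_sum, ← Finset.sum_sub_distrib]
  simp_rw [← Finset.sum_sub_distrib]
  have : ∀ P Q : Fin 5 → ℝ, ∑ k, ∑ l, P k * Q l * (a k * b l - b k * a l) =
      ∑ k, ∑ l, (P k * a k * (Q l * b l) - P k * b k * (Q l * a l)) := fun P Q =>
    Finset.sum_congr rfl fun k _ => Finset.sum_congr rfl fun l _ => by ring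
  exact this _ _

lemma tangentProj_of_orthogonal {x y : E52} (h : ip5 y x = 0) : tangentProj x y = y := by
  simp [tangentProj, h]
lemma tangentProj_self {x : E52} (h : ip5 x x = 1) : tangentProj x x = 0 := by
  simp [tangentProj, h]
lemma tangentProj_add (x y z : E52) :
    tangentProj x (y + z) = tangentProj x y + tangentProj x z := by
  simp only [tangentProj, ip5_add_left]; module
lemma tangentProj_smul (x : E52) (c : ℝ) (y : E52) :
    tangentProj x (c • y) = c • tangentProj x y := by
  simp only [tangentProj, ip5_smul_left]; module

lemma contr_wedge (a b y : E52) : contr (wedge a b) y = ip5 b y • a - ip5 a y • b := by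
  ext i
  simp [contr, wedge, ip5, sgn5, Fin.sum_univ_five]; ring

lemma contr_add_left (A B : Biv) (y : E52) : contr (A + B) y = contr A y + contr B y := by
  ext i; simp only [contr, Pi.add_apply, add_mul, Finset.sum_add_distrib]
lemma contr_smul_left (c : ℝ) (A : Biv) (y : E52) : contr (c • A) y = c • contr A y := by
  ext i; simp only [contr, Pi.smul_apply, smul_eq_mul, Finset.mul_sum, mul_assoc]
lemma contr_add_right (A : Biv) (y z : E52) : contr A (y + z) = contr A y + contr A z := by
  ext i; simp only [contr, Pi.add_apply, mul_add, Finset.sum_add_distrib]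
lemma contr_smul_right (c : ℝ) (A : Biv) (y : E52) : contr A (c • y) = c • contr A y := by
  ext i
  simp only [contr, Pi.smul_apply, smul_eq_mul, Finset.mul_sum]
  exact Finset.sum_congr rfl fun j _ => by ring

/-- The projection is self-adjoint and fixes $y$, so the factor of `bivProj` acting on the
contracted index can be moved to $y$ and disappears. -/
lemma contr_bivProj {x : E52} (A : Biv) (y : E52) (hx : ip5 y x = 0) :
    contr (bivProj x A) y = tangentProj x (contr A y) := by
  ext i
  -- Self-adjointness of the projection, tested on the standard basis vectors.
  have key : ∀ l, ∑ j, tangentProj x (Pi.single l 1) j * (sgn5 j * y j) = sgn5 l * y l := by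
    intro l
    simp only [ip5] at hx
    fin_cases l <;> simp [tangentProj, ip5, sgn5, Fin.sum_univ_five, Pi.single_apply]
    · linear_combination -x 0 * hx
    · linear_combination -x 1 * hx
    · linear_combination -x 2 * hx
    · linear_combination x 3 * hx
    · linear_combination x 4 * hx
  rw [tangentProj_eq_sum]
  simp only [contr, bivProj]
  calc ∑ j, (∑ k, ∑ l, tangentProj x (Pi.single k 1) i * tangentProj x (Pi.single l 1) j * A k l) *
        (sgn5 j * y j)
      = ∑ j, ∑ k, ∑ l, tangentProj x (Pi.single k 1) i * A k l *
          (tangentProj x (Pi.single l 1) j * (sgn5 j * y j)) := by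
        refine Finset.sum_congr rfl fun j _ => ?_
        rw [Finset.sum_mul]
        refine Finset.sum_congr rfl fun k _ => ?_
        rw [Finset.sum_mul]
        exact Finset.sum_congr rfl fun l _ => by ring
    _ = ∑ k, ∑ l, ∑ j, tangentProj x (Pi.single k 1) i * A k l *
          (tangentProj x (Pi.single l 1) j * (sgn5 j * y j)) := by
        rw [Finset.sum_comm]
        exact Finset.sum_congr rfl fun k _ => Finset.sum_comm
    _ = _ := by
        refine Finset.sum_congr rfl fun k _ => ?_
        rw [Finset.mul_sum]
        refine Finset.sum_congr rfl fun l _ => ?_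
        rw [← Finset.mul_sum, key]
        ring

end E52

/-! ### Frames, twistor bivectors and nilpotent structures -/

/-- The minus sign is the determinant of the metric of $E^3_1$. -/
lemma det_sq_eq_neg_gram (a b c : E31) :
    (Matrix.of ![a, b, c]).det ^ 2 =
      -(Matrix.of ![![ip3 a a, ip3 a b, ip3 a c], ![ip3 b a, ip3 b b, ip3 b c],
        ![ip3 c a, ip3 c b, ip3 c c]]).det := by
  simp [Matrix.det_fin_three, ip3]; ring

/-- The orientation condition makes the frame together with $x$ a basis of $E^5_2$; the remainder of
the expansion is orthogonal to all of it, hence zero. -/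
lemma IsOrientedFrame.expand {o : ℝ} {x y : E52} {e : Fin 4 → E52} (h : IsOrientedFrame o x e) (hy : ip5 y x = 0) :
    y = ip5 y (e 0) • e 0 + ip5 y (e 1) • e 1 - ip5 y (e 2) • e 2 - ip5 y (e 3) • e 3 := by
  have hdet : (Matrix.of ![e 0, e 1, e 2, e 3, x]).det ≠ 0 := by
    intro h0
    have := h.oriented
    simp [h0] at this
  set z := y - (ip5 y (e 0) • e 0 + ip5 y (e 1) • e 1 - ip5 y (e 2) • e 2 - ip5 y (e 3) • e 3)
    with hz
  have hzx : ip5 x z = 0 := by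
    rw [ip5_comm]
    simp [hz, ip5_sub_left, ip5_add_left, ip5_smul_left, hy, h.tangent]
  have hze : ∀ i, ip5 (e i) z = 0 := by
    intro i
    rw [ip5_comm]
    simp only [hz, ip5_sub_left, ip5_add_left, ip5_smul_left, h.gram]
    fin_cases i <;> simp
  have key : (Matrix.of ![e 0, e 1, e 2, e 3, x]).mulVec (fun i => sgn5 i * z i) = 0 := by
    have aux : ∀ v : E52, v ⬝ᵥ (fun i => sgn5 i * z i) = ip5 v z := by
      intro v
      simp [dotProduct, sgn5, ip5, Fin.sum_univ_five]; ring
    ext i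
    fin_cases i
    · exact (aux _).trans (hze 0)
    · exact (aux _).trans (hze 1)
    · exact (aux _).trans (hze 2)
    · exact (aux _).trans (hze 3)
    · exact (aux _).trans hzx
  have h0 := Matrix.eq_zero_of_mulVec_eq_zero hdet key
  have hz0 : z = 0 := by
    ext i
    have := congrFun h0 i
    fin_cases i <;> simpa [sgn5] using this
  exact sub_eq_zero.1 (hz.symm.trans hz0)

lemma sqrt_two_mul_inv : (√2 : ℝ) * (1 / √2) = 1 := by
  field_simp

/-- The dictionary between bivectors and paracomplex structures. The factor $-\sqrt2$ cancels the
normalization of `Omega2` and gives $e_1\mapsto e_3$ with the right sign. -/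
lemma contr_Omega2 (ε : ℝ) (e : Fin 4 → E52) (y : E52) :
    (-√2) • contr (Omega2 ε e) y =
      ip5 (e 0) y • e 2 - ip5 (e 2) y • e 0 +
        ε • (ip5 (e 3) y • e 1 - ip5 (e 1) y • e 3) := by
  rw [Omega2, contr_smul_left, contr_add_left, contr_smul_left, contr_wedge, contr_wedge, smul_smul,
    neg_mul, sqrt_two_mul_inv]
  module

lemma IsOrientedFrame.isAdmissiblePara {o ε : ℝ} {x : E52} {e : Fin 4 → E52}
    (h : IsOrientedFrame o x e) {J : E52 →ₗ[ℝ] E52}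
    (hJ : ∀ y, ip5 y x = 0 → J y = (-√2) • contr (Omega2 ε e) y) : IsAdmissiblePara ε e J := by
  refine ⟨?_, ?_, ?_, ?_⟩ <;> rw [hJ _ (h.tangent _), contr_Omega2] <;> simp [h.gram]

/-- The right-hand side involves only the bivector, so the action of $J$ on the fiber does not
depend on the admissible frame chosen for it. -/
lemma IsOrientedFrame.apply_of_isAdmissiblePara {o ε : ℝ} {x : E52} {e : Fin 4 → E52}
    (h : IsOrientedFrame o x e)
    {J : E52 →ₗ[ℝ] E52} (hJ : IsAdmissiblePara ε e J) {y : E52} (hy : ip5 y x = 0) :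
    J y = (-√2) • contr (Omega2 ε e) y := by
  rw [contr_Omega2]
  conv_lhs => rw [h.expand hy]
  obtain ⟨h0, h1, h2, h3⟩ := hJ
  simp only [map_add, map_sub, map_smul, h0, h1, h2, h3, ip5_comm _ y]
  module

lemma theta1_apply (ε : ℝ) (e : Fin 4 → E52) (y : E52) : theta1 ε e y = ip5 (xi1 ε e) y := by
  simp [theta1, coframe, ipForm, xi1, ip5_sub_left, ip5_smul_left]; ring

lemma theta2_apply (e : Fin 4 → E52) (y : E52) : theta2 e y = ip5 (xi2 e) y := by
  simp [theta2, coframe, ipForm, xi2, ip5_add_left]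

/-- Since $e_3,e_4$ are time-like, $\theta^1$ and $\theta^2$ are the metric duals of $\xi_1$ and
$\xi_2$. -/
lemma nilN_apply (ε : ℝ) (e : Fin 4 → E52) (y : E52) :
    nilN ε e y = -contr (wedge (xi1 ε e) (xi2 e)) y := by
  simp [nilN, contr_wedge, theta1_apply, theta2_apply]

lemma IsOrientedFrame.isAdmissibleNil {o ε : ℝ} (hε : ε ^ 2 = 1) {x : E52} {e : Fin 4 → E52}
    (h : IsOrientedFrame o x e) :
    IsAdmissibleNil ε ![e 0, e 1, ε • e 2, ε • e 3] (nilN ε e) := by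
  have hε' : ε * ε = 1 := by rw [← sq, hε]
  refine ⟨?_, ?_, ?_, ?_⟩ <;> rw [nilN_apply, contr_wedge] <;>
    simp [xi1, xi2, ip5_add_left, ip5_sub_left, ip5_smul_left, ip5_smul_right, h.gram, smul_smul,
      hε', -neg_add_rev, -neg_sub]
  module

/-- The twistor lift of the conformal Gauss map, in terms of the position `y` and the unit
normal vector `n`. -/
def gaussTwistor (o ε : ℝ) (y n : E31) : Biv :=
  (1 / √2) • (-o • coneStar y n + ε • wedge (coneEmb y) coneK)

variable {o ε : ℝ} {y n v w : E31} {e : Fin 4 → E52}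

/-- The vectors $e_2,e_4$ lie in the hyperbolic plane of `coneK` and `coneEmb y`. There a
pseudo-orthonormal basis has unit area up to sign and the orientation fixes the sign, so $e_4\wedge
e_2$ does not depend on the frame. The tangential half depends only on the cross product. -/
lemma IsOrientedFrame.Omega2_eq (h : IsOrientedFrame o (coneD y n) e) (ho : o ^ 2 = 1)
    (hn : ip3 n n = 1) (h0 : e 0 = coneD y v) (h2 : e 2 = coneD y w)
    (hvw : lcross v w = -o • n) : Omega2 ε e = gaussTwistor o ε y n := by
  have hdet : (Matrix.of ![v, w, n]).det = -o := by
    rw [← ip3_lcross, hvw, ip3_smul_left, hn]; ring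
  have hc : IsConfFrame (-o) 1 v w n := by
    refine ⟨by simpa using ho, one_ne_zero, ?_, ?_, ?_, hn, ?_, ?_, by simpa using hdet⟩
    · have := h.gram 0 0
      rwa [h0, ip5_coneD_coneD] at this
    · have := h.gram 2 2
      rwa [h2, ip5_coneD_coneD] at this
    · have := h.gram 0 2
      rwa [h0, h2, ip5_coneD_coneD] at this
    · have := h.tangent 0
      rwa [h0, ip5_coneD_coneD, ip3_comm] at this
    · have := h.tangent 2
      rwa [h2, ip5_coneD_coneD, ip3_comm] at this
  have hperp : ∀ i, ip5 (e i) (e 0) = 0 → ip5 (e i) (e 2) = 0 →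
      e i = (-ip5 (e i) (coneEmb y)) • coneK + (-ip5 (e i) coneK) • coneEmb y := by
    intro i hi0 hi2
    refine eq_of_orthogonal_coneD fun u => ?_
    rw [hc.expand u, sub_eq_add_neg, ← neg_smul, coneD_add, coneD_add, coneD_smul, coneD_smul,
      coneD_smul, ← h0, ← h2, ip5_add_right, ip5_add_right, ip5_smul_right, ip5_smul_right,
      ip5_smul_right, hi0, hi2, h.tangent]
    ring
  have h1 := hperp 1 (by simp [h.gram]) (by simp [h.gram])
  have h3 := hperp 3 (by simp [h.gram]) (by simp [h.gram])
  set α := -ip5 (e 1) (coneEmb y)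
  set β := -ip5 (e 1) coneK
  set γ := -ip5 (e 3) (coneEmb y)
  set δ := -ip5 (e 3) coneK
  have g11 := h.gram 1 1
  have g13 := h.gram 1 3
  have g33 := h.gram 3 3
  have hor := h.oriented
  rw [h0, h1, h2, h3, det_coneD, hdet] at hor
  simp only [h1, h3, ip5_add_left, ip5_add_right, ip5_smul_left, ip5_smul_right,
    ip5_coneEmb_coneEmb, ip5_coneK_coneK, ip5_coneK_coneEmb, ip5_coneEmb_coneK] at g11 g13 g33
  simp at g11 g13 g33
  have hpos : 0 < α * δ - β * γ := by
    have : -o * ((α * δ - β * γ) * -o) = α * δ - β * γ := by linear_combination (α * δ - β * γ) * ho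
    linarith
  -- The Gram relations read $\alpha\beta=-\frac12$, $\gamma\delta=\frac12$,
  -- $\alpha\delta+\beta\gamma=0$, and
  -- $(\alpha\delta-\beta\gamma)^2=(\alpha\delta+\beta\gamma)^2-4\alpha\beta\gamma\delta$.
  have hsq : (α * δ - β * γ) ^ 2 = 1 := by
    have : α * β = -1 / 2 := by linarith
    have h' : γ * δ = 1 / 2 := by linarith
    have h'' : α * δ + β * γ = 0 := by linarith
    linear_combination (α * δ + β * γ) * h'' - 4 * γ * δ * this + 2 * h'
  have hone : α * δ - β * γ = 1 := by nlinarith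
  rw [Omega2, gaussTwistor, h0, h1, h2, h3, wedge_coneD_coneD, hvw, coneStar_smul]
  congr 3
  simp only [wedge_add_left, wedge_add_right, wedge_smul_left, wedge_smul_right, wedge_self,
    wedge_comm coneK (coneEmb y), smul_zero, smul_neg, zero_add, add_zero]
  rw [smul_smul, smul_smul, ← neg_smul, ← add_smul]
  rw [show α * δ + -(β * γ) = 1 by linarith, one_smul]

/-- The area factor in `det_coneD` is $\frac12+\frac12=1$, and the sign $-o$ of the frame cancels
the one in the orientation of $S^4_2$. -/
lemma IsConfFrame.isOrientedFrame (h : IsConfFrame (-o) 1 v w n) :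
    IsOrientedFrame o (coneD y n) ![coneD y v, (1 / √2) • (coneK - coneEmb y), coneD y w,
      (1 / √2) • (coneK + coneEmb y)] := by
  have hs : (√2 : ℝ)⁻¹ * (√2)⁻¹ = 1 / 2 := by
    rw [← mul_inv, Real.mul_self_sqrt (by norm_num)]; norm_num
  have hs' : (√2 : ℝ)⁻¹ ^ 2 = 1 / 2 := by rw [sq, hs]
  refine ⟨fun i => ?_, fun i j => ?_, ?_⟩
  · fin_cases i <;> simp [ip5_smul_left, ip5_add_left, ip5_sub_left, ip5_coneD_coneD,
      ip5_coneEmb_coneD, ip5_coneK_coneD, ip3_comm v n, ip3_comm w n, h.na, h.nb]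
  · fin_cases i <;> fin_cases j <;>
      simp [ip5_smul_left, ip5_add_left, ip5_sub_left, ip5_smul_right, ip5_add_right,
        ip5_sub_right, ip5_coneD_coneD, ip5_coneD_coneEmb, ip5_coneD_coneK, h.aa, h.bb, h.ab,
        ip3_comm w v, ip5_coneEmb_coneD, ip5_coneK_coneD, ip5_coneK_coneK, ip5_coneEmb_coneEmb,
        ip5_coneK_coneEmb, ip5_coneEmb_coneK] <;> linarith
  · have := det_coneD y v w n (1 / √2) (-(1 / √2)) (1 / √2) (1 / √2)
    rw [h.det] at this
    simp only [Matrix.cons_val, smul_sub, smul_add] at this ⊢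
    rw [neg_smul, ← sub_eq_add_neg] at this
    rw [this]
    have ho := h.ho
    have : -o * ((1 / √2 * (1 / √2) - -(1 / √2) * (1 / √2)) * (-o * 1)) = 1 := by
      simp only [one_div]
      linear_combination 2 * (√2)⁻¹ ^ 2 * ho + 2 * hs'
    rw [this]
    exact one_pos

/-! ### Calculus on the coordinate plane -/

section Calculus

variable {V : Type*} [NormedAddCommGroup V] [NormedSpace ℝ V]

lemma IsBilinearMap.differentiableAt_fderiv {E F W G : Type*} [NormedAddCommGroup E]
    [NormedSpace ℝ E] [FiniteDimensional ℝ E] [NormedAddCommGroup F] [NormedSpace ℝ F]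
    [FiniteDimensional ℝ F] [NormedAddCommGroup W] [NormedSpace ℝ W] [NormedAddCommGroup G]
    [NormedSpace ℝ G] {B : E → F → W} (hB : IsBilinearMap ℝ B) {f : G → E} {g : G → F} {w : G}
    (hf : DifferentiableAt ℝ f w) (hg : DifferentiableAt ℝ g w) :
    DifferentiableAt ℝ (fun z => B (f z) (g z)) w ∧
      ∀ X, fderiv ℝ (fun z => B (f z) (g z)) w X =
        B (fderiv ℝ f w X) (g w) + B (f w) (fderiv ℝ g w X) := by
  have h := hB.toContinuousBilinearMap.hasFDerivAt_of_bilinear hf.hasFDerivAt hg.hasFDerivAt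
  have h' : HasFDerivAt (fun z => B (f z) (g z)) _ w := h
  refine ⟨h'.differentiableAt, fun X => ?_⟩
  rw [h'.fderiv]
  simp [add_comm]

lemma IsBilinearMap.contDiffAt {E F W G : Type*} [NormedAddCommGroup E]
    [NormedSpace ℝ E] [FiniteDimensional ℝ E] [NormedAddCommGroup F] [NormedSpace ℝ F]
    [FiniteDimensional ℝ F] [NormedAddCommGroup W] [NormedSpace ℝ W] [NormedAddCommGroup G]
    [NormedSpace ℝ G] {B : E → F → W} (hB : IsBilinearMap ℝ B) {f : G → E} {g : G → F} {w : G}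
    (hf : ContDiffAt ℝ ∞ f w) (hg : ContDiffAt ℝ ∞ g w) :
    ContDiffAt ℝ ∞ (fun z => B (f z) (g z)) w :=
  ((hB.toContinuousBilinearMap.contDiff.contDiffAt).comp w hf).clm_apply hg

lemma isBilinearMap_ip3 : IsBilinearMap ℝ ip3 :=
  ⟨ip3_add_left, ip3_smul_left, ip3_add_right, ip3_smul_right⟩

lemma isBilinearMap_lcross : IsBilinearMap ℝ lcross :=
  ⟨lcross_add_left, lcross_smul_left, lcross_add_right, lcross_smul_right⟩

lemma isBilinearMap_contr : IsBilinearMap ℝ contr :=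
  ⟨contr_add_left, contr_smul_left, contr_add_right, contr_smul_right⟩

lemma fderiv_eq_pd (f : ℝ × ℝ → V) (w X : ℝ × ℝ) :
    fderiv ℝ f w X = X.1 • pd 0 f w + X.2 • pd 1 f w := by
  have : X = X.1 • ((1, 0) : ℝ × ℝ) + X.2 • ((0, 1) : ℝ × ℝ) := by ext <;> simp
  calc fderiv ℝ f w X = fderiv ℝ f w (X.1 • ((1, 0) : ℝ × ℝ) + X.2 • ((0, 1) : ℝ × ℝ)) := by
        rw [← this]
    _ = _ := by
        rw [map_add, map_smul, map_smul]
        rfl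

lemma Filter.EventuallyEq.pd {f g : ℝ × ℝ → V} {w : ℝ × ℝ} (h : f =ᶠ[𝓝 w] g) (i : Fin 2) :
    pd i f =ᶠ[𝓝 w] pd i g := by
  filter_upwards [h.fderiv (𝕜 := ℝ)] with z hz
  simp [_root_.pd, hz]

lemma ContDiffAt.pd {f : ℝ × ℝ → V} {w : ℝ × ℝ} (h : ContDiffAt ℝ ∞ f w) (i : Fin 2) :
    ContDiffAt ℝ ∞ (pd i f) w :=
  (h.fderiv_right (m := ∞) (by simp)).clm_apply contDiffAt_const

lemma ContDiffAt.differentiableAt_infty {f : ℝ × ℝ → V} {w : ℝ × ℝ} (h : ContDiffAt ℝ ∞ f w) :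
    DifferentiableAt ℝ f w := h.differentiableAt (by simp)

lemma pd_pd_comm {f : ℝ × ℝ → V} {w : ℝ × ℝ} (h : ContDiffAt ℝ ∞ f w) (i j : Fin 2) :
    pd i (pd j f) w = pd j (pd i f) w := by
  have hd : DifferentiableAt ℝ (fderiv ℝ f) w :=
    (h.fderiv_right (m := ∞) (by simp)).differentiableAt (by simp)
  have key : ∀ i j, pd i (pd j f) w = fderiv ℝ (fderiv ℝ f) w
      ((![(1, 0), (0, 1)] : Fin 2 → ℝ × ℝ) i) ((![(1, 0), (0, 1)] : Fin 2 → ℝ × ℝ) j) := by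
    intro i j
    have : pd j f = fun z => fderiv ℝ f z ((![(1, 0), (0, 1)] : Fin 2 → ℝ × ℝ) j) := rfl
    rw [this]
    simp only [pd]
    rw [fderiv_clm_apply hd (differentiableAt_const _)]
    simp
  rw [key, key]
  exact (h.isSymmSndFDerivAt (by simpa using (WithTop.coe_le_coe.2 le_top : ((2 : ℕ∞) : ℕ∞ω) ≤ ∞))).eq _ _

lemma pd_ip3 {f g : ℝ × ℝ → E31} {w : ℝ × ℝ} (hf : DifferentiableAt ℝ f w)
    (hg : DifferentiableAt ℝ g w) (i : Fin 2) :
    pd i (fun z => ip3 (f z) (g z)) w = ip3 (pd i f w) (g w) + ip3 (f w) (pd i g w) :=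
  (isBilinearMap_ip3.differentiableAt_fderiv hf hg).2 _

lemma pd_div {f g : ℝ × ℝ → ℝ} {w : ℝ × ℝ} (hf : DifferentiableAt ℝ f w)
    (hg : DifferentiableAt ℝ g w) (h0 : g w ≠ 0) (i : Fin 2) :
    pd i (fun z => f z / g z) w = (pd i f w * g w - f w * pd i g w) / g w ^ 2 := by
  simp only [pd]
  have hi : HasFDerivAt (fun z => (g z)⁻¹) _ w :=
    (hasDerivAt_inv h0).comp_hasFDerivAt w hg.hasFDerivAt
  have := (hf.hasFDerivAt.mul hi).fderiv
  change fderiv ℝ (f * fun z => (g z)⁻¹) w _ = _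
  rw [this]
  simp
  field_simp
  ring

/-- For $g=A(du^2-dv^2)$ this is $K=-\frac1{2A}(\partial_u^2-\partial_v^2)\log|A|$, with the
logarithm expanded so that $A$ may have either sign. -/
lemma curvature_of_conformal {g : Fin 2 → Fin 2 → ℝ × ℝ → ℝ} {w : ℝ × ℝ}
    (hA : ContDiffAt ℝ ∞ (g 0 0) w) (h0 : g 0 0 w ≠ 0) (h01 : g 0 1 =ᶠ[𝓝 w] 0)
    (h10 : g 1 0 =ᶠ[𝓝 w] 0) (h11 : g 1 1 =ᶠ[𝓝 w] -g 0 0) :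
    curvature g w =
      -((pd 0 (pd 0 (g 0 0)) w - pd 1 (pd 1 (g 0 0)) w) / (2 * g 0 0 w) -
        (pd 0 (g 0 0) w ^ 2 - pd 1 (g 0 0) w ^ 2) / (2 * g 0 0 w ^ 2)) / g 0 0 w := by
  have hne : ∀ᶠ z in 𝓝 w, g 0 0 z ≠ 0 := hA.continuousAt.eventually_ne h0
  have hpd0 : ∀ (i : Fin 2) z, pd i (0 : ℝ × ℝ → ℝ) z = 0 := by intro i z; simp [pd]
  have hpdneg : ∀ (i : Fin 2) z, pd i (-g 0 0) z = -pd i (g 0 0) z := by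
    intro i z; simp [pd, fderiv_neg]
  -- The symbol is $A_u/2A$ if the indices $i,j,k$ contain an even number of ones, and $A_v/2A$
  -- otherwise.
  have hchr : ∀ᶠ z in 𝓝 w, ∀ k i j, christoffel g k i j z =
      if k = if i = j then 0 else 1 then pd 0 (g 0 0) z / (2 * g 0 0 z)
        else pd 1 (g 0 0) z / (2 * g 0 0 z) := by
    filter_upwards [hne, h01, h10, h11, h01.pd 0, h01.pd 1, h10.pd 0, h10.pd 1, h11.pd 0, h11.pd 1]
      with z hz e01 e10 e11 a1 a2 a3 a4 a5 a6
    have hinv : (Matrix.of fun a b => g a b z)⁻¹ = !![1 / g 0 0 z, 0; 0, -(1 / g 0 0 z)] := by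
      apply Matrix.inv_eq_right_inv
      ext i j
      fin_cases i <;> fin_cases j <;> simp [Matrix.mul_apply, e01, e10, e11, hz]
    intro k i j
    simp only [christoffel, hinv, Fin.sum_univ_two]
    fin_cases k <;> fin_cases i <;> fin_cases j <;>
      simp [a1, a2, a3, a4, a5, a6, hpd0, hpdneg] <;> field_simp
  have hd : ∀ i, DifferentiableAt ℝ (fun z => pd i (g 0 0) z) w :=
    fun i => (hA.pd i).differentiableAt_infty
  have hd2 : DifferentiableAt ℝ (fun z => 2 * g 0 0 z) w :=
    (hA.differentiableAt_infty).const_mul 2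
  have hpd2 : ∀ i, pd i (fun z => 2 * g 0 0 z) w = 2 * pd i (g 0 0) w := by
    intro i
    simp only [pd]
    rw [fderiv_const_mul hA.differentiableAt_infty]
    simp
  have hdc : ∀ c k i j, pd c (christoffel g k i j) w =
      pd c (fun z => if k = if i = j then 0 else 1 then pd 0 (g 0 0) z / (2 * g 0 0 z)
        else pd 1 (g 0 0) z / (2 * g 0 0 z)) w := by
    intro c k i j
    refine Filter.EventuallyEq.eq_of_nhds (Filter.EventuallyEq.pd ?_ c)
    filter_upwards [hchr] with z hz using hz k i j
  simp only [curvature, riemann, Fin.sum_univ_two, hdc, hchr.self_of_nhds, h01.self_of_nhds,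
    h10.self_of_nhds, h11.self_of_nhds]
  simp
  rw [pd_div (hd 0) hd2 (by simpa using h0), pd_div (hd 1) hd2 (by simpa using h0), hpd2, hpd2]
  field_simp
  ring

end Calculus

/-! ### Minimal surfaces in coordinates -/

lemma pd_const_mul (c : ℝ) {g : ℝ × ℝ → ℝ} {w : ℝ × ℝ} (hg : DifferentiableAt ℝ g w) (i : Fin 2) :
    pd i (fun z => c * g z) w = c * pd i g w := by
  simp only [pd]
  rw [fderiv_const_mul hg]
  simp

lemma coneD_eq (y v : E31) : coneD y v = ip3 y v • coneK + coneD 0 v := by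
  ext i; fin_cases i <;> simp [coneD, coneK, ip3]

lemma coneEmb_eq (y : E31) :
    coneEmb y = (1 / 2 : ℝ) • (ip3 y y • coneK) + coneD 0 y + coneEmb 0 := by
  ext i; fin_cases i <;> simp [coneD, coneK, coneEmb, ip3] <;> ring

lemma wedge_coneK_coneD (y v : E31) : wedge coneK (coneD y v) = wedge coneK (coneD 0 v) := by
  rw [coneD_eq y v, wedge_add_right, wedge_smul_right, wedge_self, smul_zero, zero_add]

/-- The quadratic part of `coneEmb` is along `coneK` and drops out, leaving an affine function of
$y$. -/
lemma wedge_coneEmb_coneK (y : E31) :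
    wedge (coneEmb y) coneK = wedge (coneD 0 y) coneK + wedge (coneEmb 0) coneK := by
  rw [coneEmb_eq y, wedge_add_left, wedge_add_left, wedge_smul_left, wedge_smul_left, wedge_self]
  simp

/-- Moving the base point changes `coneD` only along `coneK`; the cross product records this change.
-/
lemma coneStar_eq (y n : E31) :
    coneStar y n = coneStar 0 n + wedge coneK (coneD 0 (lcross y n)) := by
  ext i j
  fin_cases i <;> fin_cases j <;> simp [coneStar, wedge, coneD, coneK, lcross, ip3] <;> ring

/-- `coneD` at the origin as a linear map. -/
def coneDL : E31 →L[ℝ] E52 :=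
  LinearMap.toContinuousLinearMap
    { toFun := coneD 0
      map_add' := coneD_add 0
      map_smul' := fun c v => coneD_smul c 0 v }

lemma coneDL_apply (v : E31) : coneDL v = coneD 0 v := rfl

/-- The part of `gaussTwistor` that is linear in the unit normal vector. -/
def twistorL1 (o : ℝ) : E31 →L[ℝ] Biv :=
  LinearMap.toContinuousLinearMap
    { toFun := fun v => (1 / √2) • (-o • coneStar 0 v)
      map_add' := fun u v => by simp only [coneStar_add, smul_add]
      map_smul' := fun c v => by
        simp only [coneStar_smul, RingHom.id_apply, smul_smul]
        congr 1; ring }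

/-- Right wedge product with `coneK` on the image of `coneD`. -/
def wedgeKL : E31 →L[ℝ] Biv :=
  LinearMap.toContinuousLinearMap
    { toFun := fun v => (1 / √2) • wedge (coneD 0 v) coneK
      map_add' := fun u v => by simp only [coneD_add, wedge_add_left, smul_add]
      map_smul' := fun c v => by
        simp only [coneD_smul, wedge_smul_left, RingHom.id_apply, smul_smul]
        congr 1; ring }

lemma gaussTwistor_eq (o ε : ℝ) (y n : E31) :
    gaussTwistor o ε y n = twistorL1 o n + o • wedgeKL (lcross y n) + ε • wedgeKL y +
      ε • ((1 / √2) • wedge (coneEmb 0) coneK) := by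
  change _ = (1 / √2) • (-o • coneStar 0 n) + o • ((1 / √2) • wedge (coneD 0 (lcross y n)) coneK) +
    ε • ((1 / √2) • wedge (coneD 0 y) coneK) + _
  rw [gaussTwistor, coneStar_eq, wedge_coneEmb_coneK, wedge_comm coneK]
  module

lemma fderiv_coneEmb (y v : E31) : fderiv ℝ coneEmb y v = coneD y v := by
  have h := isBilinearMap_ip3.differentiableAt_fderiv (f := id) (g := id) (w := y)
    differentiableAt_id differentiableAt_id
  have h1 : HasFDerivAt (fun z => (1 / 2 : ℝ) • (ip3 z z • coneK) + coneDL z + coneEmb 0)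
      _ y := (((h.1.hasFDerivAt.smul_const coneK).const_smul (1 / 2 : ℝ)).add
        coneDL.hasFDerivAt).add_const (coneEmb 0)
  have h2 : coneEmb = fun z => (1 / 2 : ℝ) • (ip3 z z • coneK) + coneDL z + coneEmb 0 := by
    funext z; exact coneEmb_eq z
  rw [h2, h1.fderiv]
  have h3 := h.2 v
  simp only [id] at h3
  simp [h3, coneDL_apply, ip3_comm v y]
  rw [coneD_eq y v]
  module

section

variable {o ε : ℝ} {f n : ℝ × ℝ → E31} {w : ℝ × ℝ}

/-- By `gaussTwistor_eq` only the cross product $f\times n$ is nonlinear. In its derivative,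
$f\times dn$ restores the base point of the `coneStar` term, and $df\times n$ is the new term. -/
lemma differentiableAt_gaussTwistor (hf : DifferentiableAt ℝ f w) (hn : DifferentiableAt ℝ n w) :
    DifferentiableAt ℝ (fun z => gaussTwistor o ε (f z) (n z)) w ∧ ∀ X,
    fderiv ℝ (fun z => gaussTwistor o ε (f z) (n z)) w X =
      (1 / √2) • (-o • (coneStar (f w) (fderiv ℝ n w X) +
        wedge coneK (coneD (f w) (lcross (fderiv ℝ f w X) (n w)))) +
        ε • wedge (coneD (f w) (fderiv ℝ f w X)) coneK) := by
  obtain ⟨h1, h2⟩ := isBilinearMap_lcross.differentiableAt_fderiv hf hn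
  have h := ((((twistorL1 o).hasFDerivAt.comp w hn.hasFDerivAt).add
    ((wedgeKL.hasFDerivAt.comp w h1.hasFDerivAt).const_smul o)).add
    ((wedgeKL.hasFDerivAt.comp w hf.hasFDerivAt).const_smul ε)).add_const
    (ε • ((1 / √2) • wedge (coneEmb 0) coneK))
  have h' := h.congr_of_eventuallyEq (f₁ := fun z => gaussTwistor o ε (f z) (n z))
    (Filter.Eventually.of_forall fun z => gaussTwistor_eq o ε (f z) (n z))
  refine ⟨h'.differentiableAt, fun X => ?_⟩
  rw [h'.fderiv]
  simp only [add_apply, smul_apply,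
    ContinuousLinearMap.comp_apply, h2]
  change (1 / √2) • (-o • coneStar 0 (fderiv ℝ n w X)) +
    o • ((1 / √2) • wedge (coneD 0 (_ + _)) coneK) +
    ε • ((1 / √2) • wedge (coneD 0 (fderiv ℝ f w X)) coneK) = _
  rw [coneStar_eq (f w), wedge_coneK_coneD (f w), wedge_comm (coneD (f w) _), wedge_coneK_coneD (f w),
    coneD_add, wedge_add_left, wedge_comm coneK, wedge_comm coneK, wedge_comm coneK]
  module

lemma fderiv_coneD (hf : DifferentiableAt ℝ f w) (hn : DifferentiableAt ℝ n w) (X : ℝ × ℝ) :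
    fderiv ℝ (fun z => coneD (f z) (n z)) w X =
      ip3 (fderiv ℝ f w X) (n w) • coneK + coneD (f w) (fderiv ℝ n w X) := by
  obtain ⟨h1, h2⟩ := isBilinearMap_ip3.differentiableAt_fderiv hf hn
  have h := (h1.hasFDerivAt.smul_const coneK).add (coneDL.hasFDerivAt.comp w hn.hasFDerivAt)
  have h' := h.congr_of_eventuallyEq (f₁ := fun z => coneD (f z) (n z))
    (Filter.Eventually.of_forall fun z => coneD_eq (f z) (n z))
  rw [h'.fderiv]
  simp [h2, coneDL_apply]
  rw [coneD_eq (f w)]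
  module

/-- `f` is a smooth conformal time-like minimal immersion near `w`, with unit normal vector
field `n`. -/
structure IsMinimalNear (o : ℝ) (f n : ℝ × ℝ → E31) (w : ℝ × ℝ) : Prop where
  smooth_near : ∀ᶠ z in 𝓝 w, ContDiffAt ℝ ∞ f z
  frame : ∀ᶠ z in 𝓝 w,
    IsConfFrame o (ip3 (pd 0 f z) (pd 0 f z)) (pd 0 f z) (pd 1 f z) (n z)
  minimal : ip3 (pd 1 (pd 1 f) w) (n w) = ip3 (pd 0 (pd 0 f) w) (n w)

namespace IsMinimalNear

lemma smooth (h : IsMinimalNear o f n w) : ContDiffAt ℝ ∞ f w := h.smooth_near.self_of_nhds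

/-- Smoothness of the normal is not assumed: it follows from $n=(oA)^{-1}f_u\times f_v$. -/
lemma smooth_n (h : IsMinimalNear o f n w) : ContDiffAt ℝ ∞ n w := by
  have hA : ContDiffAt ℝ ∞ (fun z => ip3 (pd 0 f z) (pd 0 f z)) w :=
    isBilinearMap_ip3.contDiffAt (h.smooth.pd 0) (h.smooth.pd 0)
  have h1 : ContDiffAt ℝ ∞ (fun z => (o * ip3 (pd 0 f z) (pd 0 f z))⁻¹ •
      lcross (pd 0 f z) (pd 1 f z)) w := by
    refine ((contDiffAt_const.mul hA).inv ?_).smul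
      (isBilinearMap_lcross.contDiffAt (h.smooth.pd 0) (h.smooth.pd 1))
    have := h.frame.self_of_nhds
    refine mul_ne_zero (fun h0 => ?_) this.hA
    have := this.ho
    simp [h0] at this
  refine h1.congr_of_eventuallyEq ?_
  filter_upwards [h.frame] with z hz
  rw [hz.lcross_ab, smul_smul, inv_mul_cancel₀, one_smul]
  refine mul_ne_zero (fun h0 => ?_) hz.hA
  have := hz.ho
  simp [h0] at this

/-- The Weingarten equations. -/
lemma pd_n (h : IsMinimalNear o f n w) {A l m : ℝ} (hA : A = ip3 (pd 0 f w) (pd 0 f w))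
    (hl : l = ip3 (pd 0 (pd 0 f) w) (n w)) (hm : m = ip3 (pd 0 (pd 1 f) w) (n w)) :
    pd 0 n w = (-(l / A)) • pd 0 f w + (m / A) • pd 1 f w ∧
      pd 1 n w = (-(m / A)) • pd 0 f w + (l / A) • pd 1 f w := by
  have hw := h.frame.self_of_nhds
  have hn := h.smooth_n.differentiableAt_infty
  have hd := fun i => (h.smooth.pd i).differentiableAt_infty
  have key : ∀ i j, ip3 (n w) (pd i (pd j f) w) = -ip3 (pd i n w) (pd j f w) := by
    intro i j
    have h0 : (fun z => ip3 (n z) (pd j f z)) =ᶠ[𝓝 w] fun _ => 0 := by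
      filter_upwards [h.frame] with z hz
      fin_cases j
      · exact hz.na
      · exact hz.nb
    have h1 := (h0.pd i).self_of_nhds
    rw [pd_ip3 hn (hd j)] at h1
    simp [pd] at h1
    simp only [pd]
    linarith
  have key2 : ∀ i, ip3 (pd i n w) (n w) = 0 := by
    intro i
    have h0 : (fun z => ip3 (n z) (n z)) =ᶠ[𝓝 w] fun _ => 1 := by
      filter_upwards [h.frame] with z hz using hz.nn
    have h1 := (h0.pd i).self_of_nhds
    rw [pd_ip3 hn hn, ip3_comm (n w)] at h1
    simp [pd] at h1
    simp only [pd]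
    linarith
  have k00 := key 0 0
  have k01 := key 0 1
  have k10 := key 1 0
  have k11 := key 1 1
  rw [pd_pd_comm h.smooth 1 0, ip3_comm, ← hm] at k10
  -- Minimality: the coefficients of $n$ in $f_{vv}$ and $f_{uu}$ agree, so $l$ occurs in both
  -- diagonal entries.
  rw [ip3_comm, h.minimal, ← hl] at k11
  rw [ip3_comm, ← hl] at k00
  rw [ip3_comm, ← hm] at k01
  rw [← hA] at hw
  have hA0 := hw.hA
  constructor
  · rw [hw.expand (pd 0 n w), key2, show ip3 (pd 0 n w) (pd 0 f w) = -l by linarith,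
      show ip3 (pd 0 n w) (pd 1 f w) = -m by linarith]
    module
  · rw [hw.expand (pd 1 n w), key2, show ip3 (pd 1 n w) (pd 0 f w) = -m by linarith,
      show ip3 (pd 1 n w) (pd 1 f w) = -l by linarith]
    module

/-- The Weingarten map is trace free, so its square is the scalar $(l^2-m^2)/A^2$ by
Cayley–Hamilton, and the third fundamental form is that multiple of the first. -/
lemma ip3_fderiv_n (h : IsMinimalNear o f n w) (X : ℝ × ℝ) :
    ip3 (fderiv ℝ n w X) (fderiv ℝ n w X) =
      (ip3 (pd 0 (pd 0 f) w) (n w) ^ 2 - ip3 (pd 0 (pd 1 f) w) (n w) ^ 2) /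
        ip3 (pd 0 f w) (pd 0 f w) ^ 2 * ip3 (fderiv ℝ f w X) (fderiv ℝ f w X) := by
  obtain ⟨h1, h2⟩ := h.pd_n rfl rfl rfl
  have hw := h.frame.self_of_nhds
  have hA := hw.hA
  simp only [fderiv_eq_pd, h1, h2, ip3_add_left, ip3_add_right, ip3_smul_left, ip3_smul_right,
    hw.bb, hw.ab, ip3_comm (pd 1 f w) (pd 0 f w)]
  field_simp
  ring

/-- The Gauss equation. -/
lemma curvature_eq (h : IsMinimalNear o f n w) :
    curvature (fun i j z => ip3 (pd i f z) (pd j f z)) w =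
      -((ip3 (pd 0 (pd 0 f) w) (n w) ^ 2 - ip3 (pd 0 (pd 1 f) w) (n w) ^ 2) /
        ip3 (pd 0 f w) (pd 0 f w) ^ 2) := by
  have hs := h.smooth
  have hw := h.frame.self_of_nhds
  have hd : ∀ᶠ z in 𝓝 w, ContDiffAt ℝ ∞ f z := h.smooth_near
  have hd' := fun i => (hs.pd i).differentiableAt_infty
  have e00 : pd 0 (fun z => ip3 (pd 0 f z) (pd 0 f z)) =ᶠ[𝓝 w]
      fun z => 2 * ip3 (pd 0 (pd 0 f) z) (pd 0 f z) := by
    filter_upwards [hd] with z hz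
    rw [pd_ip3 (hz.pd 0).differentiableAt_infty (hz.pd 0).differentiableAt_infty, ip3_comm (pd 0 f z)]
    ring
  have e11 : (fun z => ip3 (pd 1 f z) (pd 1 f z)) =ᶠ[𝓝 w]
      fun z => -ip3 (pd 0 f z) (pd 0 f z) := by
    filter_upwards [h.frame] with z hz using hz.bb
  have e01 : (fun z => ip3 (pd 0 f z) (pd 1 f z)) =ᶠ[𝓝 w] fun z => 0 := by
    filter_upwards [h.frame] with z hz using hz.ab
  have e10 : (fun z => ip3 (pd 1 f z) (pd 0 f z)) =ᶠ[𝓝 w] fun z => 0 := by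
    filter_upwards [h.frame] with z hz
    rw [ip3_comm, hz.ab]
  have d11 : ∀ᶠ z in 𝓝 w, ∀ i, 2 * ip3 (pd i (pd 1 f) z) (pd 1 f z) =
      -(2 * ip3 (pd i (pd 0 f) z) (pd 0 f z)) := by
    filter_upwards [hd, e11.pd 0, e11.pd 1] with z hz h0 h1
    have hz0 := (hz.pd 0).differentiableAt_infty
    have hz1 := (hz.pd 1).differentiableAt_infty
    have hneg : ∀ i, pd i (fun z => -ip3 (pd 0 f z) (pd 0 f z)) z =
        -pd i (fun z => ip3 (pd 0 f z) (pd 0 f z)) z := fun i => by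
      simp only [pd]
      rw [fderiv_fun_neg]
      simp
    rw [hneg, pd_ip3 hz1 hz1, pd_ip3 hz0 hz0] at h0 h1
    rw [ip3_comm (pd 0 f z), ip3_comm (pd 1 f z)] at h0 h1
    intro i
    fin_cases i
    · simp at h0 ⊢; linarith
    · simp at h1 ⊢; linarith
  have d01 : ∀ᶠ z in 𝓝 w, ∀ i, ip3 (pd i (pd 0 f) z) (pd 1 f z) =
      -ip3 (pd i (pd 1 f) z) (pd 0 f z) := by
    filter_upwards [hd, e01.pd 0, e01.pd 1] with z hz h0 h1
    have hz0 := (hz.pd 0).differentiableAt_infty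
    have hz1 := (hz.pd 1).differentiableAt_infty
    rw [pd_ip3 hz0 hz1, ip3_comm (pd 0 f z)] at h0 h1
    simp [pd] at h0 h1
    intro i
    fin_cases i
    · simp [pd]; linarith
    · simp [pd]; linarith
  have comm : ∀ᶠ z in 𝓝 w, pd 1 (pd 0 f) z = pd 0 (pd 1 f) z := by
    filter_upwards [hd] with z hz using pd_pd_comm hz 1 0
  -- Writing $A_u=2\langle f_{vv},f_u\rangle$ and $A_v=2\langle f_{uv},f_u\rangle$ makes the third
  -- derivative $f_{uvv}$ appear in both $A_{uu}$ and $A_{vv}$, so it cancels in the difference.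
  have a0 : pd 0 (fun z => ip3 (pd 0 f z) (pd 0 f z)) =ᶠ[𝓝 w]
      fun z => 2 * ip3 (pd 1 (pd 1 f) z) (pd 0 f z) := by
    filter_upwards [e00, d11, d01, comm] with z h0 h1 h2 h3
    have := h1 0
    have := h2 1
    rw [h3] at this
    rw [h0]
    linarith
  have a1 : pd 1 (fun z => ip3 (pd 0 f z) (pd 0 f z)) =ᶠ[𝓝 w]
      fun z => 2 * ip3 (pd 0 (pd 1 f) z) (pd 0 f z) := by
    filter_upwards [hd, comm] with z hz h3
    rw [pd_ip3 (hz.pd 0).differentiableAt_infty (hz.pd 0).differentiableAt_infty,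
      ip3_comm (pd 0 f z), h3]
    ring
  have p2 : ∀ (i j k : Fin 2), pd i (fun z => 2 * ip3 (pd j (pd k f) z) (pd 0 f z)) w =
      2 * (ip3 (pd i (pd j (pd k f)) w) (pd 0 f w) +
        ip3 (pd j (pd k f) w) (pd i (pd 0 f) w)) := by
    intro i j k
    have hjk := ((hs.pd k).pd j).differentiableAt_infty
    rw [← pd_ip3 hjk (hd' 0),
      ← pd_const_mul 2 (isBilinearMap_ip3.differentiableAt_fderiv hjk (hd' 0)).1]
  have a00 := (a0.pd 0).self_of_nhds
  have a11 := (a1.pd 1).self_of_nhds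
  rw [p2] at a00 a11
  rw [pd_pd_comm (hs.pd 1) 1 0, comm.self_of_nhds] at a11
  rw [curvature_of_conformal (isBilinearMap_ip3.contDiffAt (hs.pd 0) (hs.pd 0)) hw.hA e01 e10 e11]
  simp only [a00, a11]
  have b0 := a0.self_of_nhds
  have b1 := a1.self_of_nhds
  have b00 := e00.self_of_nhds
  have c0 := d11.self_of_nhds 0
  have c1 := d11.self_of_nhds 1
  have c2 := d01.self_of_nhds 0
  have c3 := d01.self_of_nhds 1
  rw [comm.self_of_nhds] at c1 c3
  rw [b0, b1]
  set A := ip3 (pd 0 f w) (pd 0 f w) with hA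
  have hA0 : A ≠ 0 := hw.hA
  set P := ip3 (pd 1 (pd 1 f) w) (pd 0 f w) with hP
  set Q := ip3 (pd 0 (pd 1 f) w) (pd 0 f w) with hQ
  -- Expanding second derivatives in the frame: the tangential contributions in $P,Q$ cancel the
  -- first-order terms of the curvature formula, and the normal ones give $l^2-m^2$.
  have i1 : ip3 (pd 1 (pd 1 f) w) (pd 0 (pd 0 f) w) =
      (P ^ 2 - Q ^ 2) / A + ip3 (pd 0 (pd 0 f) w) (n w) ^ 2 := by
    rw [hw.expand (pd 0 (pd 0 f) w)]
    simp only [sub_eq_add_neg, ← neg_smul, ip3_add_right, ip3_smul_right, h.minimal]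
    have x1 : ip3 (pd 0 (pd 0 f) w) (pd 0 f w) = P := by linarith
    have x2 : ip3 (pd 1 (pd 1 f) w) (pd 1 f w) = -Q := by linarith
    rw [x1, x2, ← hP, c2]
    field_simp
    simp only [ip3_add_left, ip3_smul_left, ip3_comm (pd 0 f w) (n w),
      ip3_comm (pd 1 f w) (n w), hw.na, hw.nb, hw.nn]
    ring
  have i2 : ip3 (pd 0 (pd 1 f) w) (pd 0 (pd 1 f) w) =
      (Q ^ 2 - P ^ 2) / A + ip3 (pd 0 (pd 1 f) w) (n w) ^ 2 := by
    conv_lhs => rw [hw.expand (pd 0 (pd 1 f) w)]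
    have x2 : ip3 (pd 0 (pd 1 f) w) (pd 1 f w) = -P := by linarith
    simp only [sub_eq_add_neg, ← neg_smul, ip3_add_left, ip3_add_right, ip3_smul_left,
      ip3_smul_right, x2, ← hQ, hw.bb, hw.ab, hw.nn, ip3_comm (pd 1 f w) (pd 0 f w),
      ip3_comm (pd 0 f w) (n w), ip3_comm (pd 1 f w) (n w), hw.na, hw.nb, ← hA]
    field_simp
    ring
  rw [i1, i2]
  field_simp
  ring

/-- The differential of the conformal Gauss map. -/
lemma fderiv_gauss (h : IsMinimalNear o f n w) (X : ℝ × ℝ) :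
    fderiv ℝ (fun z => coneD (f z) (n z)) w X = coneD (f w) (fderiv ℝ n w X) := by
  have hw := h.frame.self_of_nhds
  rw [fderiv_coneD h.smooth.differentiableAt_infty h.smooth_n.differentiableAt_infty,
    ip3_comm, fderiv_eq_pd f, ip3_add_right, ip3_smul_right, ip3_smul_right, hw.na, hw.nb]
  simp

/-- What survives the projection is $\frac1{\sqrt2}\bigl((\varepsilon+j)\,df(X)\bigr)\wedge$
`coneK`. The scalar comes out because $(\varepsilon+j)(X_1+jX_2)=(X_1+\varepsilon
X_2)(\varepsilon+j)$. -/
lemma bivProj_fderiv_gaussTwistor (h : IsMinimalNear o f n w) (hε : ε ^ 2 = 1) (X : ℝ × ℝ) :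
    bivProj (coneD (f w) (n w)) (fderiv ℝ (fun z => gaussTwistor o ε (f z) (n z)) w X) =
      ((X.1 + ε * X.2) / √2) •
        wedge (coneD (f w) (ε • pd 0 f w + pd 1 f w)) coneK := by
  have hw := h.frame.self_of_nhds
  have hoo : o * o = 1 := by rw [← sq, hw.ho]
  have hεε : ε * ε = 1 := by rw [← sq, hε]
  obtain ⟨hu, hv⟩ := h.pd_n rfl rfl rfl
  rw [(differentiableAt_gaussTwistor h.smooth.differentiableAt_infty
    h.smooth_n.differentiableAt_infty).2]
  have hK : tangentProj (coneD (f w) (n w)) coneK = coneK :=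
    tangentProj_of_orthogonal (ip5_coneK_coneD _ _)
  have hF : tangentProj (coneD (f w) (n w)) (coneD (f w) (n w)) = 0 :=
    tangentProj_self (by rw [ip5_coneD_coneD, hw.nn])
  have ha : tangentProj (coneD (f w) (n w)) (coneD (f w) (pd 0 f w)) = coneD (f w) (pd 0 f w) :=
    tangentProj_of_orthogonal (by rw [ip5_coneD_coneD, ip3_comm, hw.na])
  have hb : tangentProj (coneD (f w) (n w)) (coneD (f w) (pd 1 f w)) = coneD (f w) (pd 1 f w) :=
    tangentProj_of_orthogonal (by rw [ip5_coneD_coneD, ip3_comm, hw.nb])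
  -- The dual of a tangent vector is a wedge with the factor `coneD f n`, the base point itself,
  -- which the projection annihilates.
  have hsa : bivProj (coneD (f w) (n w)) (coneStar (f w) (pd 0 f w)) = 0 := by
    have : coneStar (f w) (pd 0 f w) = o • wedge (coneD (f w) (pd 1 f w)) (coneD (f w) (n w)) := by
      rw [wedge_coneD_coneD, hw.lcross_bn, coneStar_smul, smul_smul, hoo, one_smul]
    rw [this, bivProj_smul, bivProj_wedge, hF]
    ext i j; simp [wedge]
  have hsb : bivProj (coneD (f w) (n w)) (coneStar (f w) (pd 1 f w)) = 0 := by
    have : coneStar (f w) (pd 1 f w) = o • wedge (coneD (f w) (pd 0 f w)) (coneD (f w) (n w)) := by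
      rw [wedge_coneD_coneD, hw.lcross_an, coneStar_smul, smul_smul, hoo, one_smul]
    rw [this, bivProj_smul, bivProj_wedge, hF]
    ext i j; simp [wedge]
  simp only [fderiv_eq_pd, hu, hv, coneStar_add, coneStar_smul, coneD_add, coneD_smul,
    lcross_add_left, lcross_smul_left, hw.lcross_an, hw.lcross_bn, bivProj_add, bivProj_smul,
    bivProj_wedge, hK, ha, hb, hsa, hsb, wedge_add_left, wedge_add_right, wedge_smul_left,
    wedge_smul_right, smul_zero]
  rw [wedge_comm coneK (coneD (f w) (pd 1 f w)), wedge_comm coneK (coneD (f w) (pd 0 f w))]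
  have e1 : ∀ s t : Biv, (1 / √2) • (-o • (0 + 0 + (X.1 • o • -t + X.2 • o • -s)) +
      ε • (X.1 • s + X.2 • t)) = ((X.1 + ε * X.2) / √2) • (ε • s + t) := by
    intro s t
    have : ((X.1 + ε * X.2) / √2) • (ε • s + t) =
      (1 / √2) • ((X.1 * ε + (ε * ε) * X.2) • s + (X.1 + ε * X.2) • t) := by module
    rw [this, hεε]
    have : (1 / √2) • (-o • (0 + 0 + (X.1 • o • -t + X.2 • o • -s)) +
      ε • (X.1 • s + X.2 • t)) = (1 / √2) • ((X.1 * ε + (o * o) * X.2) • s +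
        (o * o * X.1 + ε * X.2) • t) := by
      module
    rw [this, hoo, one_mul, one_mul]
  rw [← e1]
  simp only [add_zero, smul_zero]

end IsMinimalNear

end

/-! ### Local paracomplex coordinates -/

lemma comp_symm_eventuallyEq {M β : Type*} [TopologicalSpace M]
    {φ ψ : OpenPartialHomeomorph M (ℝ × ℝ)} {p : M} (f : M → β)
    (hp : p ∈ φ.source) (hp' : p ∈ ψ.source) :
    f ∘ φ.symm =ᶠ[𝓝 (φ p)] (f ∘ ψ.symm) ∘ (ψ ∘ φ.symm) := by
  have h : ∀ᶠ z in 𝓝 (φ p), φ.symm z ∈ ψ.source :=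
    (φ.symm.continuousAt (φ.map_source hp)).eventually_mem
      (ψ.open_source.mem_nhds (by simpa [φ.left_inv hp] using hp'))
  filter_upwards [h] with z hz
  simp [ψ.left_inv hz]

section Charts

variable {M : Type*} [TopologicalSpace M] [ChartedSpace (ℝ × ℝ) M]
variable {V : Type*} [NormedAddCommGroup V] [NormedSpace ℝ V]

/-- `dAt` in the preferred chart; both sides are zero if `f` is not differentiable. -/
lemma dAt_eq_fderiv_chartAt (f : M → V) (p : M) :
    dAt f p = fderiv ℝ (f ∘ (chartAt (ℝ × ℝ) p).symm) (chartAt (ℝ × ℝ) p p) := by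
  have hw : writtenInExtChartAt 𝓘(ℝ, ℝ × ℝ) 𝓘(ℝ, V) p f = f ∘ (chartAt (ℝ × ℝ) p).symm := by
    ext z; simp [writtenInExtChartAt, chartAt_self_eq]
  have key : MDifferentiableAt 𝓘(ℝ, ℝ × ℝ) 𝓘(ℝ, V) f p ↔
      DifferentiableAt ℝ (f ∘ (chartAt (ℝ × ℝ) p).symm) (chartAt (ℝ × ℝ) p p) := by
    rw [mdifferentiableAt_iff, hw]
    simp only [modelWithCornersSelf_coe, Set.range_id, differentiableWithinAt_univ]
    constructor
    · intro h; simpa using h.2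
    · intro h
      refine ⟨?_, by simpa using h⟩
      have h1 := h.continuousAt.comp (x := p)
        ((chartAt (ℝ × ℝ) p).continuousAt (mem_chart_source _ p))
      refine h1.congr ?_
      filter_upwards [(chartAt (ℝ × ℝ) p).open_source.mem_nhds (mem_chart_source _ p)] with q hq
      simp [(chartAt (ℝ × ℝ) p).left_inv hq]
  by_cases h : MDifferentiableAt 𝓘(ℝ, ℝ × ℝ) 𝓘(ℝ, V) f p
  · refine h.mfderiv.trans ?_
    rw [hw]
    simp
    rfl
  · rw [fderiv_zero_of_not_differentiableAt (fun h' => h (key.2 h'))]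
    exact mfderiv_zero_of_not_mdifferentiableAt h

/-- The differential at `p` of the local coordinates `φ`. -/
def coordD (φ : OpenPartialHomeomorph M (ℝ × ℝ)) (p : M) : (ℝ × ℝ) →L[ℝ] (ℝ × ℝ) :=
  fderiv ℝ (φ ∘ (chartAt (ℝ × ℝ) p).symm) (chartAt (ℝ × ℝ) p p)

variable {φ ψ : OpenPartialHomeomorph M (ℝ × ℝ)} {p : M}

lemma transition_smooth (hφ : φ ∈ paraholomorphicGroupoid.maximalAtlas M)
    (hψ : ψ ∈ paraholomorphicGroupoid.maximalAtlas M) (hp : p ∈ φ.source) (hp' : p ∈ ψ.source) :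
    ContDiffAt ℝ ∞ (ψ ∘ φ.symm) (φ p) ∧
      ∀ X, fderiv ℝ (ψ ∘ φ.symm) (φ p) (parJ X) = parJ (fderiv ℝ (ψ ∘ φ.symm) (φ p) X) := by
  have h := paraholomorphicGroupoid.compatible_of_mem_maximalAtlas hφ hψ
  have h' := (mem_groupoid_of_pregroupoid.1 h).1
  have hmem : φ p ∈ (φ.symm.trans ψ).source := by
    simp [hp, hp']
  exact ⟨h'.1.contDiffAt ((φ.symm.trans ψ).open_source.mem_nhds hmem), fun X => h'.2 _ hmem X⟩

/-- Exchanging $u$ and $v$ is multiplication by $j$, which is paraholomorphic. It is needed where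
$\partial/\partial u$ is time-like. -/
lemma swap_mem_maximalAtlas (hφ : φ ∈ paraholomorphicGroupoid.maximalAtlas M) :
    φ.trans (Homeomorph.prodComm ℝ ℝ).toOpenPartialHomeomorph ∈
      paraholomorphicGroupoid.maximalAtlas M := by
  have hs : (Homeomorph.prodComm ℝ ℝ).toOpenPartialHomeomorph ∈ paraholomorphicGroupoid := by
    have hJ : (Prod.swap : ℝ × ℝ → ℝ × ℝ) = parJ := by
      funext x; rfl
    refine mem_groupoid_of_pregroupoid.2 ⟨?_, ?_⟩
    · change ContDiffOn ℝ ∞ (Prod.swap : ℝ × ℝ → ℝ × ℝ) _ ∧ ∀ x ∈ _, ∀ X,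
        fderiv ℝ (Prod.swap : ℝ × ℝ → ℝ × ℝ) x (parJ X) = parJ (fderiv ℝ Prod.swap x X)
      rw [hJ]
      exact ⟨parJ.contDiff.contDiffOn, fun x _ X => by simp⟩
    · change ContDiffOn ℝ ∞ (Prod.swap : ℝ × ℝ → ℝ × ℝ) _ ∧ ∀ x ∈ _, ∀ X,
        fderiv ℝ (Prod.swap : ℝ × ℝ → ℝ × ℝ) x (parJ X) = parJ (fderiv ℝ Prod.swap x X)
      rw [hJ]
      exact ⟨parJ.contDiff.contDiffOn, fun x _ X => by simp⟩
  intro e he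
  obtain ⟨h1, h2⟩ := hφ e he
  constructor
  · rw [OpenPartialHomeomorph.trans_symm_eq_symm_trans_symm, OpenPartialHomeomorph.trans_assoc]
    exact paraholomorphicGroupoid.trans (paraholomorphicGroupoid.symm hs) h1
  · rw [← OpenPartialHomeomorph.trans_assoc]
    exact paraholomorphicGroupoid.trans h2 hs

/-- Allows a chart to be shrunk to the open set where $\partial/\partial u$ is space-like. -/
instance : ClosedUnderRestriction paraholomorphicGroupoid := by
  unfold paraholomorphicGroupoid
  refine (closedUnderRestriction_iff_id_le _).2 ?_
  rw [StructureGroupoid.le_iff]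
  rintro e ⟨s, hs, hes⟩
  refine StructureGroupoid.mem_of_eqOnSource _ ?_ hes
  refine mem_groupoid_of_pregroupoid.2 ⟨?_, ?_⟩
  · exact ⟨contDiffOn_id, fun x _ X => by simp⟩
  · exact ⟨contDiffOn_id, fun x _ X => by simp⟩

variable [HasGroupoid M paraholomorphicGroupoid]

lemma coordD_parJ (hφ : φ ∈ paraholomorphicGroupoid.maximalAtlas M) (hp : p ∈ φ.source)
    (X : ℝ × ℝ) : coordD φ p (parJ X) = parJ (coordD φ p X) :=
  (transition_smooth (paraholomorphicGroupoid.chart_mem_maximalAtlas p) hφ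
    (mem_chart_source _ p) hp).2 X

lemma dAt_eq_comp (hφ : φ ∈ paraholomorphicGroupoid.maximalAtlas M) (hp : p ∈ φ.source)
    {f : M → V} (hf : DifferentiableAt ℝ (f ∘ φ.symm) (φ p)) (X : ℝ × ℝ) :
    dAt f p X = fderiv ℝ (f ∘ φ.symm) (φ p) (coordD φ p X) := by
  have hc := mem_chart_source (ℝ × ℝ) p
  rw [dAt_eq_fderiv_chartAt, (comp_symm_eventuallyEq f hc hp).fderiv_eq]
  have h1 := (transition_smooth (paraholomorphicGroupoid.chart_mem_maximalAtlas p) hφ hc hp).1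
  rw [fderiv_comp]
  · simp [coordD, (chartAt (ℝ × ℝ) p).left_inv hc]
  · simpa [(chartAt (ℝ × ℝ) p).left_inv hc] using hf
  · exact h1.differentiableAt (by simp)

lemma coordD_surjective (hφ : φ ∈ paraholomorphicGroupoid.maximalAtlas M) (hp : p ∈ φ.source) :
    Function.Surjective (coordD φ p) := by
  have hc := mem_chart_source (ℝ × ℝ) p
  have hd := ((transition_smooth hφ (paraholomorphicGroupoid.chart_mem_maximalAtlas p) hp
    hc).1.differentiableAt (by simp))
  have h2 := (transition_smooth (paraholomorphicGroupoid.chart_mem_maximalAtlas p) hφ hc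
    hp).1.differentiableAt (by simp)
  have h1 : (φ ∘ φ.symm) =ᶠ[𝓝 (φ p)] id := by
    filter_upwards [φ.open_target.mem_nhds (φ.map_source hp)] with z hz
    simp [φ.right_inv hz]
  have h3 := (h1.symm.trans (comp_symm_eventuallyEq φ hp hc)).fderiv_eq (𝕜 := ℝ)
  rw [fderiv_comp _ (by simpa [φ.left_inv hp] using h2) hd, fderiv_id] at h3
  intro Y
  refine ⟨fderiv ℝ (chartAt (ℝ × ℝ) p ∘ φ.symm) (φ p) Y, ?_⟩
  have := DFunLike.congr_fun h3 Y
  simp [φ.left_inv hp] at this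
  exact this.symm

lemma contDiffAt_comp_symm (hφ : φ ∈ paraholomorphicGroupoid.maximalAtlas M) (hp : p ∈ φ.source)
    {f : M → V} (hf : ContMDiffAt 𝓘(ℝ, ℝ × ℝ) 𝓘(ℝ, V) ∞ f p) :
    ContDiffAt ℝ ∞ (f ∘ φ.symm) (φ p) := by
  have hc := mem_chart_source (ℝ × ℝ) p
  have h1 := (contMDiffAt_iff.1 hf).2
  simp [chartAt_self_eq, contDiffWithinAt_univ] at h1
  have h2 := (transition_smooth hφ (paraholomorphicGroupoid.chart_mem_maximalAtlas p) hp hc).1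
  refine ContDiffAt.congr_of_eventuallyEq (ContDiffAt.comp _ ?_ h2)
    (comp_symm_eventuallyEq f hp hc)
  simpa [φ.left_inv hp] using h1

end Charts

/-! ### The conformal Gauss map in local coordinates -/

/-- The Gram matrix gives the determinant up to sign; the sign comes from the orientation condition
on whichever coordinate vector is space-like. -/
lemma isConfFrame_of_conformal {o : ℝ} (ho : o ^ 2 = 1) {D : (ℝ × ℝ) →L[ℝ] E31} {n : E31}
    (hconf : ∀ Y, ip3 (D (parJ Y)) (D (parJ Y)) = -ip3 (D Y) (D Y))
    (hsp : ∃ Y, 0 < ip3 (D Y) (D Y)) (hunit : ip3 n n = 1) (hnormal : ∀ Y, ip3 n (D Y) = 0)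
    (hor : ∀ Y, 0 < ip3 (D Y) (D Y) → 0 < o * (Matrix.of ![D Y, D (parJ Y), n]).det) :
    IsConfFrame o (ip3 (D (1, 0)) (D (1, 0))) (D (1, 0)) (D (0, 1)) n := by
  have j1 : parJ (1, 0) = (0, 1) := rfl
  have j2 : parJ (0, 1) = (1, 0) := rfl
  have hexp : ∀ Y, D Y = Y.1 • D (1, 0) + Y.2 • D (0, 1) := by
    intro Y
    calc D Y = D (Y.1 • ((1, 0) : ℝ × ℝ) + Y.2 • ((0, 1) : ℝ × ℝ)) := by congr 1; ext <;> simp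
      _ = _ := by rw [map_add, map_smul, map_smul]
  have hbb := hconf (1, 0)
  rw [j1] at hbb
  -- The vector $(1,1)$ is fixed by $j$, so it is null, and polarization gives orthogonality.
  have hab : ip3 (D (1, 0)) (D (0, 1)) = 0 := by
    have := hconf (1, 1)
    rw [show parJ (1, 1) = (1, 1) from rfl, hexp] at this
    simp only [one_smul, ip3_add_left, ip3_add_right, hbb, ip3_comm (D (0, 1)) (D (1, 0))] at this
    linarith
  have hA : ip3 (D (1, 0)) (D (1, 0)) ≠ 0 := by
    intro h0
    obtain ⟨Y, hY⟩ := hsp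
    rw [hexp] at hY
    simp only [ip3_add_left, ip3_add_right, ip3_smul_left, ip3_smul_right, hbb, hab, h0,
      ip3_comm (D (0, 1)) (D (1, 0))] at hY
    simp at hY
  refine ⟨ho, hA, rfl, hbb, hab, hunit, hnormal _, hnormal _, ?_⟩
  have hsq := det_sq_eq_neg_gram (D (1, 0)) (D (0, 1)) n
  rw [ip3_comm _ n, ip3_comm _ n, ip3_comm (D (0, 1)) (D (1, 0)), hnormal, hnormal, hab, hbb,
    hunit] at hsq
  set A := ip3 (D (1, 0)) (D (1, 0))
  have hsq' : (Matrix.of ![D (1, 0), D (0, 1), n]).det ^ 2 = A ^ 2 := by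
    rw [hsq]; simp [Matrix.det_fin_three]; ring
  have hpos : 0 < o * A * (Matrix.of ![D (1, 0), D (0, 1), n]).det := by
    rcases lt_or_gt_of_ne hA with h | h
    · have := hor (0, 1) (by rw [hbb]; linarith)
      rw [j2] at this
      have hsw : (Matrix.of ![D (0, 1), D (1, 0), n]).det =
          -(Matrix.of ![D (1, 0), D (0, 1), n]).det := by
        simp [Matrix.det_fin_three]; ring
      rw [hsw] at this
      nlinarith
    · have := hor (1, 0) h
      rw [j1] at this
      nlinarith
  have hprod : ((Matrix.of ![D (1, 0), D (0, 1), n]).det - o * A) *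
      ((Matrix.of ![D (1, 0), D (0, 1), n]).det + o * A) = 0 := by
    linear_combination hsq' - A ^ 2 * ho
  rcases mul_eq_zero.1 hprod with h | h
  · linarith
  · rw [show (Matrix.of ![D (1, 0), D (0, 1), n]).det = -(o * A) by linarith] at hpos
    nlinarith [sq_nonneg (o * A)]

section Plane

variable {o ε : ℝ} {f n : ℝ × ℝ → E31} {w : ℝ × ℝ}

lemma fderiv_parJ_eq_pd {V : Type*} [NormedAddCommGroup V] [NormedSpace ℝ V] (f : ℝ × ℝ → V)
    (w X : ℝ × ℝ) : fderiv ℝ f w (parJ X) = X.2 • pd 0 f w + X.1 • pd 1 f w := by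
  rw [fderiv_eq_pd]; rfl

/-- The Weingarten equations say that $dn$ anticommutes with $j$. Hence the sign $-o$, opposite to
the sign in `IsConfFrame.lcross_ab`. -/
lemma IsMinimalNear.lcross_fderiv_n (h : IsMinimalNear o f n w) (X : ℝ × ℝ) :
    lcross (fderiv ℝ n w X) (fderiv ℝ n w (parJ X)) =
      (-o * ip3 (fderiv ℝ n w X) (fderiv ℝ n w X)) • n w := by
  obtain ⟨hu, hv⟩ := h.pd_n rfl rfl rfl
  have hw := h.frame.self_of_nhds
  have hA := hw.hA
  rw [fderiv_parJ_eq_pd, fderiv_eq_pd n, hu, hv]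
  simp only [lcross_add_left, lcross_add_right, lcross_smul_left, lcross_smul_right, lcross_self,
    lcross_comm (pd 1 f w) (pd 0 f w), hw.lcross_ab, ip3_add_left, ip3_add_right, ip3_smul_left,
    ip3_smul_right, hw.bb, hw.ab, ip3_comm (pd 1 f w) (pd 0 f w)]
  rw [← sub_eq_zero]
  match_scalars
  field_simp
  ring

lemma IsMinimalNear.span_pd_n (h : IsMinimalNear o f n w)
    (hD : ip3 (pd 0 (pd 0 f) w) (n w) ^ 2 - ip3 (pd 0 (pd 1 f) w) (n w) ^ 2 ≠ 0) (u : E31) :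
    ∃ (X : ℝ × ℝ) (c : ℝ), u = fderiv ℝ n w X + c • n w := by
  obtain ⟨hu, hv⟩ := h.pd_n rfl rfl rfl
  have hw := h.frame.self_of_nhds
  have hA := hw.hA
  set l := ip3 (pd 0 (pd 0 f) w) (n w)
  set m := ip3 (pd 0 (pd 1 f) w) (n w)
  -- Cramer's rule for the Weingarten equations.
  refine ⟨((ip3 u (pd 0 f w) * (-l) - ip3 u (pd 1 f w) * (-m)) / (l ^ 2 - m ^ 2),
    (ip3 u (pd 0 f w) * m - ip3 u (pd 1 f w) * l) / (l ^ 2 - m ^ 2)), ip3 u (n w), ?_⟩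
  conv_lhs => rw [hw.expand u]
  rw [fderiv_eq_pd, hu, hv]
  match_scalars <;> field_simp <;> ring

end Plane

/-! ### Covariant derivatives of endomorphisms given by contraction -/

section Surface

variable {M : Type*} [TopologicalSpace M] [ChartedSpace (ℝ × ℝ) M]
  {V : Type*} [NormedAddCommGroup V] [NormedSpace ℝ V] {p : M}

lemma dAt_congr {f g : M → V} (h : f =ᶠ[𝓝 p] g) : dAt f p = dAt g p := by
  rw [dAt_eq_fderiv_chartAt, dAt_eq_fderiv_chartAt]
  refine Filter.EventuallyEq.fderiv_eq ?_
  have hc := mem_chart_source (ℝ × ℝ) p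
  have ht := (chartAt (ℝ × ℝ) p).symm.continuousAt ((chartAt (ℝ × ℝ) p).map_source hc)
  rw [ContinuousAt, (chartAt (ℝ × ℝ) p).left_inv hc] at ht
  exact ht.eventually h

/-- If `J` acts by contraction with a section of twistor bivectors, then so does its covariant
derivative. -/
lemma covDeriv_end_eq {F Y : M → E52} {Ω : M → Biv} {J : M → E52 →ₗ[ℝ] E52} {o ε : ℝ}
    {e : Fin 4 → E52} (hF : ip5 (F p) (F p) = 1) (he : IsOrientedFrame o (F p) e)
    (hΩe : Ω p = Omega2 ε e)
    (hΩ : DifferentiableAt ℝ (Ω ∘ (chartAt (ℝ × ℝ) p).symm) (chartAt (ℝ × ℝ) p p))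
    (hJ : ∀ᶠ q in 𝓝 p, ∀ y, ip5 y (F q) = 0 → J q y = (-√2) • contr (Ω q) y)
    (hY : DifferentiableAt ℝ (Y ∘ (chartAt (ℝ × ℝ) p).symm) (chartAt (ℝ × ℝ) p p))
    (hYF : ∀ᶠ q in 𝓝 p, ip5 (Y q) (F q) = 0) (X : ℝ × ℝ) :
    nabla F (fun q => J q (Y q)) p X - J p (nabla F Y p X) =
      (-√2) • contr (nablaBiv F Ω p X) (Y p) := by
  have hc := (chartAt (ℝ × ℝ) p).left_inv (mem_chart_source (ℝ × ℝ) p)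
  have hcong : (fun q => J q (Y q)) =ᶠ[𝓝 p] fun q => (-√2) • contr (Ω q) (Y q) := by
    filter_upwards [hJ, hYF] with q h1 h2 using h1 _ h2
  obtain ⟨hd1, hd2⟩ := isBilinearMap_contr.differentiableAt_fderiv hΩ hY
  have hd : dAt (fun q => J q (Y q)) p X =
      (-√2) • (contr (dAt Ω p X) (Y p) + contr (Ω p) (dAt Y p X)) := by
    rw [dAt_congr hcong]
    simp only [dAt_eq_fderiv_chartAt]
    have := hd2 X
    simp only [Function.comp_apply, hc] at this
    rw [← this]
    change fderiv ℝ (fun z => (-√2) • contr (Ω ((chartAt (ℝ × ℝ) p).symm z))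
      (Y ((chartAt (ℝ × ℝ) p).symm z))) _ X = _
    simp only [Function.comp_apply] at hd1
    rw [fderiv_fun_const_smul hd1]
    rfl
  -- The bivector at $p$ annihilates $F(p)$ and takes values in the fiber, so the tangential
  -- projection passes through its contraction on either side.
  have hcx : contr (Ω p) (F p) = 0 := by
    have h1 : (-√2) • contr (Ω p) (F p) = 0 := by
      rw [hΩe, contr_Omega2]
      simp [he.tangent]
    exact (smul_eq_zero.1 h1).resolve_left (by simp)
  have hcp : ∀ y, tangentProj (F p) (contr (Ω p) y) = contr (Ω p) y := by
    intro y
    refine tangentProj_of_orthogonal ?_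
    have h1 : ip5 ((-√2) • contr (Ω p) y) (F p) = 0 := by
      rw [hΩe, contr_Omega2]
      simp [ip5_add_left, ip5_sub_left, ip5_smul_left, he.tangent]
    rw [ip5_smul_left] at h1
    exact (mul_eq_zero.1 h1).resolve_left (by simp)
  have hcp' : ∀ y, contr (Ω p) (tangentProj (F p) y) = contr (Ω p) y := by
    intro y
    rw [tangentProj, sub_eq_add_neg, ← neg_smul, contr_add_right, contr_smul_right, hcx, smul_zero,
      add_zero]
  have hperp : ip5 (tangentProj (F p) (dAt Y p X)) (F p) = 0 := by
    rw [tangentProj, ip5_sub_left, ip5_smul_left, hF]; ring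
  rw [nabla, nabla, hd, hJ.self_of_nhds _ hperp, hcp', tangentProj_smul, tangentProj_add, hcp,
    nablaBiv, contr_bivProj _ _ hYF.self_of_nhds]
  module

end Surface

/-! ### The twistor lift on the surface -/

section Surface

variable {M : Type*} [TopologicalSpace M] [ChartedSpace (ℝ × ℝ) M]
  [HasGroupoid M paraholomorphicGroupoid] {ι n : M → E31} {o ε : ℝ}
  {φ : OpenPartialHomeomorph M (ℝ × ℝ)} {p : M}

lemma conformalGaussMap_eq {N : Type*} (ι n : N → E31) :
    conformalGaussMap ι n = fun q => coneD (ι q) (n q) := by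
  funext q
  exact fderiv_coneEmb _ _

/-- A time-like minimal surface: the standing hypotheses. -/
structure IsMinimalSurface (o : ℝ) (ι n : M → E31) : Prop where
  ho : o ^ 2 = 1
  imm : IsTimelikeConformalImmersion ι
  normal : IsUnitNormal o ι n
  minimal : IsMinimal ι n

namespace IsMinimalSurface

lemma contDiffAt (h : IsMinimalSurface o ι n)
    (hφ : φ ∈ paraholomorphicGroupoid.maximalAtlas M) (hp : p ∈ φ.source) :
    ContDiffAt ℝ ∞ (ι ∘ φ.symm) (φ p) :=
  contDiffAt_comp_symm hφ hp (h.imm.smooth p)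

lemma isConfFrame (h : IsMinimalSurface o ι n)
    (hφ : φ ∈ paraholomorphicGroupoid.maximalAtlas M) (hp : p ∈ φ.source) :
    IsConfFrame o (ip3 (pd 0 (ι ∘ φ.symm) (φ p)) (pd 0 (ι ∘ φ.symm) (φ p)))
      (pd 0 (ι ∘ φ.symm) (φ p)) (pd 1 (ι ∘ φ.symm) (φ p)) (n p) := by
  have hd := (h.contDiffAt hφ hp).differentiableAt_infty
  have hι : ∀ X, dAt ι p X = fderiv ℝ (ι ∘ φ.symm) (φ p) (coordD φ p X) := dAt_eq_comp hφ hp hd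
  have hs := coordD_surjective hφ hp
  refine isConfFrame_of_conformal h.ho (D := fderiv ℝ (ι ∘ φ.symm) (φ p)) ?_ ?_ (h.normal.unit p)
    ?_ ?_
  · intro Y
    obtain ⟨X, rfl⟩ := hs Y
    rw [← coordD_parJ hφ hp, ← hι, ← hι]
    exact h.imm.conformal p X
  · obtain ⟨X, hX⟩ := h.imm.exists_spacelike p
    exact ⟨coordD φ p X, by rwa [← hι]⟩
  · intro Y
    obtain ⟨X, rfl⟩ := hs Y
    rw [← hι]
    exact h.normal.normal p X
  · intro Y
    obtain ⟨X, rfl⟩ := hs Y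
    rw [← coordD_parJ hφ hp, ← hι, ← hι]
    exact h.normal.oriented p X

lemma isMinimalNear (h : IsMinimalSurface o ι n)
    (hφ : φ ∈ paraholomorphicGroupoid.maximalAtlas M) (hp : p ∈ φ.source) :
    IsMinimalNear o (ι ∘ φ.symm) (n ∘ φ.symm) (φ p) := by
  have ht := φ.open_target.mem_nhds (φ.map_source hp)
  have hw := h.isConfFrame hφ hp
  refine ⟨?_, ?_, ?_⟩
  · filter_upwards [ht] with z hz
    have := h.contDiffAt hφ (φ.map_target hz)
    rwa [φ.right_inv hz] at this
  · filter_upwards [ht] with z hz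
    have := h.isConfFrame hφ (φ.map_target hz)
    rwa [φ.right_inv hz] at this
  · have := h.minimal φ hφ p hp
    simp only [meanCurv, secondFF, inducedMetric, chartD2, hw.bb, hw.ab] at this
    simp only [Function.comp_apply, φ.left_inv hp]
    set A := ip3 (pd 0 (ι ∘ φ.symm) (φ p)) (pd 0 (ι ∘ φ.symm) (φ p))
    have hA : A ≠ 0 := hw.hA
    have hA2 : (2 : ℝ) * (A * -A - 0 ^ 2) ≠ 0 := by
      intro h0
      apply hA
      nlinarith
    rw [div_eq_zero_iff, or_iff_left hA2] at this
    have h2 : A * (ip3 (pd 1 (pd 1 (ι ∘ φ.symm)) (φ p)) (n p) -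
        ip3 (pd 0 (pd 0 (ι ∘ φ.symm)) (φ p)) (n p)) = 0 := by
      linear_combination this
    linarith [(mul_eq_zero.1 h2).resolve_left hA]

lemma dAt_immersion (h : IsMinimalSurface o ι n)
    (hφ : φ ∈ paraholomorphicGroupoid.maximalAtlas M) (hp : p ∈ φ.source) (X : ℝ × ℝ) :
    dAt ι p X = fderiv ℝ (ι ∘ φ.symm) (φ p) (coordD φ p X) :=
  dAt_eq_comp hφ hp (h.isMinimalNear hφ hp).smooth.differentiableAt_infty X

lemma dAt_normal (h : IsMinimalSurface o ι n)
    (hφ : φ ∈ paraholomorphicGroupoid.maximalAtlas M) (hp : p ∈ φ.source) (X : ℝ × ℝ) :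
    dAt n p X = fderiv ℝ (n ∘ φ.symm) (φ p) (coordD φ p X) :=
  dAt_eq_comp hφ hp (h.isMinimalNear hφ hp).smooth_n.differentiableAt_infty X

lemma fderiv_gauss (h : IsMinimalSurface o ι n)
    (hφ : φ ∈ paraholomorphicGroupoid.maximalAtlas M) (hp : p ∈ φ.source) (Y : ℝ × ℝ) :
    fderiv ℝ (conformalGaussMap ι n ∘ φ.symm) (φ p) Y =
      coneD (ι p) (fderiv ℝ (n ∘ φ.symm) (φ p) Y) := by
  have := (h.isMinimalNear hφ hp).fderiv_gauss Y
  simp only [Function.comp_apply, φ.left_inv hp] at this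
  rw [conformalGaussMap_eq]
  exact this

lemma dAt_gauss (h : IsMinimalSurface o ι n) (p : M) (X : ℝ × ℝ) :
    dAt (conformalGaussMap ι n) p X = coneD (ι p) (dAt n p X) := by
  have hc := mem_chart_source (ℝ × ℝ) p
  have := h.fderiv_gauss (paraholomorphicGroupoid.chart_mem_maximalAtlas p) hc X
  rw [dAt_eq_fderiv_chartAt, dAt_eq_fderiv_chartAt]
  exact this

lemma gaussCurv_chartAt (h : IsMinimalSurface o ι n) (p : M) :
    gaussCurv ι p = -((secondFF ι n (chartAt (ℝ × ℝ) p) 0 0 p ^ 2 -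
      secondFF ι n (chartAt (ℝ × ℝ) p) 0 1 p ^ 2) /
        inducedMetric ι (chartAt (ℝ × ℝ) p) 0 0 (chartAt (ℝ × ℝ) p p) ^ 2) := by
  have hc := mem_chart_source (ℝ × ℝ) p
  have := (h.isMinimalNear (paraholomorphicGroupoid.chart_mem_maximalAtlas p) hc).curvature_eq
  simp only [Function.comp_apply, (chartAt (ℝ × ℝ) p).left_inv hc] at this
  exact this

lemma third_fundamental_form (h : IsMinimalSurface o ι n)
    (hφ : φ ∈ paraholomorphicGroupoid.maximalAtlas M) (hp : p ∈ φ.source) (X : ℝ × ℝ) :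
    ip3 (dAt n p X) (dAt n p X) = (secondFF ι n φ 0 0 p ^ 2 - secondFF ι n φ 0 1 p ^ 2) /
      inducedMetric ι φ 0 0 (φ p) ^ 2 * ip3 (dAt ι p X) (dAt ι p X) := by
  have := (h.isMinimalNear hφ hp).ip3_fderiv_n (coordD φ p X)
  simp only [Function.comp_apply, φ.left_inv hp] at this
  rw [h.dAt_immersion hφ hp, h.dAt_normal hφ hp, this]
  rfl

/-- The Gauss equation in arbitrary local coordinates. -/
lemma gaussCurv_eq (h : IsMinimalSurface o ι n)
    (hφ : φ ∈ paraholomorphicGroupoid.maximalAtlas M) (hp : p ∈ φ.source) :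
    gaussCurv ι p = -((secondFF ι n φ 0 0 p ^ 2 - secondFF ι n φ 0 1 p ^ 2) /
      inducedMetric ι φ 0 0 (φ p) ^ 2) := by
  -- Both charts give the same ratio of the third to the first fundamental form on a non-null
  -- vector, so no transformation law of the curvature is needed.
  obtain ⟨X, hX⟩ := h.imm.exists_spacelike p
  have h1 := h.third_fundamental_form hφ hp X
  rw [h.third_fundamental_form (paraholomorphicGroupoid.chart_mem_maximalAtlas p)
    (mem_chart_source _ p) X] at h1
  rw [h.gaussCurv_chartAt, mul_right_cancel₀ hX.ne' h1]

/-- The definition of the curvature uses a chart that varies with the point; the Gauss equation in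
one fixed chart gives a continuous function $l^2-m^2$ with the same zeros. -/
lemma reg_mem_nhds (h : IsMinimalSurface o ι n) (hp : p ∈ Reg ι) : Reg ι ∈ 𝓝 p := by
  have hφ := paraholomorphicGroupoid.chart_mem_maximalAtlas (M := M) p
  have hc := mem_chart_source (ℝ × ℝ) p
  set φ := chartAt (ℝ × ℝ) p
  have hm := h.isMinimalNear hφ hc
  have hcont : ContinuousAt (fun z => ip3 (pd 0 (pd 0 (ι ∘ φ.symm)) z) ((n ∘ φ.symm) z) ^ 2 -
      ip3 (pd 0 (pd 1 (ι ∘ φ.symm)) z) ((n ∘ φ.symm) z) ^ 2) (φ p) :=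
    (((isBilinearMap_ip3.contDiffAt ((hm.smooth.pd 0).pd 0) hm.smooth_n).pow 2).sub
      ((isBilinearMap_ip3.contDiffAt ((hm.smooth.pd 1).pd 0) hm.smooth_n).pow 2)).continuousAt
  have h0 : (fun z => ip3 (pd 0 (pd 0 (ι ∘ φ.symm)) z) ((n ∘ φ.symm) z) ^ 2 -
      ip3 (pd 0 (pd 1 (ι ∘ φ.symm)) z) ((n ∘ φ.symm) z) ^ 2) (φ p) ≠ 0 := by
    intro h0
    apply hp
    simp only [Function.comp_apply, φ.left_inv hc] at h0
    rw [h.gaussCurv_eq hφ hc]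
    simp only [secondFF, chartD2, h0]
    simp
  have hev := (φ.continuousAt hc).eventually (hcont.eventually_ne h0)
  filter_upwards [hev, φ.open_source.mem_nhds hc] with q hq hqs
  simp only [Function.comp_apply, φ.left_inv hqs] at hq
  change gaussCurv ι q ≠ 0
  rw [h.gaussCurv_eq hφ hqs, neg_ne_zero]
  exact div_ne_zero hq (pow_ne_zero 2 (h.isConfFrame hφ hqs).hA)

lemma lcross_dAt_normal (h : IsMinimalSurface o ι n) (p : M) (X : ℝ × ℝ) :
    lcross (dAt n p X) (dAt n p (parJ X)) = (-o * ip3 (dAt n p X) (dAt n p X)) • n p := by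
  have hc := mem_chart_source (ℝ × ℝ) p
  have := (h.isMinimalNear (paraholomorphicGroupoid.chart_mem_maximalAtlas p)
    hc).lcross_fderiv_n X
  simp only [dAt_eq_fderiv_chartAt]
  rw [this, Function.comp_apply, (chartAt (ℝ × ℝ) p).left_inv hc]

lemma Omega2_eq (h : IsMinimalSurface o ι n) {e : Fin 4 → E52}
    (he : IsAdaptedFrame o (conformalGaussMap ι n) p e) :
    Omega2 ε e = gaussTwistor o ε (ι p) (n p) := by
  obtain ⟨h1, X, h0, h2⟩ := he
  have hg := h1.gram 0 0
  rw [h.dAt_gauss] at h0 h2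
  rw [h0, ip5_coneD_coneD] at hg
  rw [conformalGaussMap_eq] at h1
  refine h1.Omega2_eq h.ho (h.normal.unit p) h0 h2 ?_
  rw [h.lcross_dAt_normal, hg]
  simp

/-- Where the curvature is nonzero, $F$ and $dF$ span the image of `coneD`, so $\nu$ lies in the
plane of `coneK` and `coneEmb ι`; the two remaining conditions leave only `coneK`. -/
lemma dualNormal_eq (h : IsMinimalSurface o ι n) {ν : M → E52} (hν : IsDualNormal ι n ν)
    (hp : p ∈ Reg ι) : ν p = coneK := by
  have hφ := paraholomorphicGroupoid.chart_mem_maximalAtlas (M := M) p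
  have hc := mem_chart_source (ℝ × ℝ) p
  have hm := h.isMinimalNear hφ hc
  have hD : ip3 (pd 0 (pd 0 (ι ∘ (chartAt (ℝ × ℝ) p).symm)) (chartAt (ℝ × ℝ) p p))
      ((n ∘ (chartAt (ℝ × ℝ) p).symm) (chartAt (ℝ × ℝ) p p)) ^ 2 -
      ip3 (pd 0 (pd 1 (ι ∘ (chartAt (ℝ × ℝ) p).symm)) (chartAt (ℝ × ℝ) p p))
      ((n ∘ (chartAt (ℝ × ℝ) p).symm) (chartAt (ℝ × ℝ) p p)) ^ 2 ≠ 0 := by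
    intro h0
    apply hp
    simp only [Function.comp_apply, (chartAt (ℝ × ℝ) p).left_inv hc] at h0
    rw [h.gaussCurv_eq hφ hc]
    simp only [secondFF, chartD2, h0]
    simp
  have hperp : ∀ u, ip5 (ν p) (coneD (ι p) u) = 0 := by
    intro u
    obtain ⟨X, c, hu⟩ := hm.span_pd_n hD u
    rw [Function.comp_apply, (chartAt (ℝ × ℝ) p).left_inv hc, ← dAt_eq_fderiv_chartAt] at hu
    have h1 := hν.normal p hp X
    have h2 := hν.tangent p hp
    rw [h.dAt_gauss] at h1
    rw [conformalGaussMap_eq] at h2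
    rw [hu, coneD_add, coneD_smul, ip5_add_right, ip5_smul_right, h1, h2]
    ring
  have h3 := eq_of_orthogonal_coneD hperp
  rw [hν.dual p hp, neg_neg, one_smul] at h3
  have h4 := hν.null p hp
  rw [h3] at h4
  simp only [ip5_add_left, ip5_add_right, ip5_smul_left, ip5_smul_right, ip5_coneK_coneK,
    ip5_coneEmb_coneEmb, ip5_coneEmb_coneK, ip5_coneK_coneEmb] at h4
  have h5 : ip5 (ν p) coneK = 0 := by linarith
  rw [h3, h5]
  simp

lemma isDualNormal_coneK (h : IsMinimalSurface o ι n) : IsDualNormal ι n fun _ => coneK := by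
  refine ⟨fun p _ => ip5_coneK_coneK, fun p _ => ?_, fun p _ X => ?_,
    fun p _ => ip5_coneK_coneEmb _⟩
  · rw [conformalGaussMap_eq, ip5_coneK_coneD]
  · rw [h.dAt_gauss, ip5_coneK_coneD]

omit [HasGroupoid M paraholomorphicGroupoid] in
lemma ip5_gauss (h : IsMinimalSurface o ι n) (p : M) :
    ip5 (conformalGaussMap ι n p) (conformalGaussMap ι n p) = 1 := by
  rw [conformalGaussMap_eq, ip5_coneD_coneD, h.normal.unit]

lemma differentiableAt_gaussTwistor (h : IsMinimalSurface o ι n)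
    (hφ : φ ∈ paraholomorphicGroupoid.maximalAtlas M) (hp : p ∈ φ.source) :
    DifferentiableAt ℝ ((fun q => gaussTwistor o ε (ι q) (n q)) ∘ φ.symm) (φ p) :=
  have hm := h.isMinimalNear hφ hp
  (_root_.differentiableAt_gaussTwistor hm.smooth.differentiableAt_infty
    hm.smooth_n.differentiableAt_infty).1

lemma nablaBiv_eq (h : IsMinimalSurface o ι n) (hε : ε ^ 2 = 1)
    (hφ : φ ∈ paraholomorphicGroupoid.maximalAtlas M) (hp : p ∈ φ.source) {Ω : M → Biv}
    (hΩ : Ω =ᶠ[𝓝 p] fun q => gaussTwistor o ε (ι q) (n q)) (X : ℝ × ℝ) :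
    nablaBiv (conformalGaussMap ι n) Ω p X =
      (((coordD φ p X).1 + ε * (coordD φ p X).2) / √2) •
        wedge (coneD (ι p) (ε • pd 0 (ι ∘ φ.symm) (φ p) + pd 1 (ι ∘ φ.symm) (φ p))) coneK := by
  have hm := (h.isMinimalNear hφ hp).bivProj_fderiv_gaussTwistor hε (coordD φ p X)
  simp only [Function.comp_apply, φ.left_inv hp] at hm
  rw [nablaBiv, dAt_congr hΩ, dAt_eq_comp hφ hp (h.differentiableAt_gaussTwistor hφ hp),
    conformalGaussMap_eq]
  exact hm

lemma isFullyLightlikeAt (h : IsMinimalSurface o ι n) (hε : ε ^ 2 = 1) {Ω : M → Biv}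
    (hΩ : Ω =ᶠ[𝓝 p] fun q => gaussTwistor o ε (ι q) (n q)) :
    IsFullyLightlikeAt (conformalGaussMap ι n) Ω p := by
  have hφ := paraholomorphicGroupoid.chart_mem_maximalAtlas (M := M) p
  have hc := mem_chart_source (ℝ × ℝ) p
  have key := h.nablaBiv_eq hε hφ hc hΩ
  have hw := h.isConfFrame hφ hc
  refine ⟨fun X => ?_, ?_, ⟨_, fun X => ⟨_, key X⟩⟩⟩
  · rw [key, bivIp_smul_smul, bivIp_wedge_self, ip5_coneK_coneK, ip5_coneD_coneK]
    ring
  · obtain ⟨X, hX⟩ := coordD_surjective hφ hc (1, 0)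
    refine ⟨X, fun h0 => ?_⟩
    rw [key, hX] at h0
    set a := pd 0 (ι ∘ (chartAt (ℝ × ℝ) p).symm) (chartAt (ℝ × ℝ) p p)
    set b := pd 1 (ι ∘ (chartAt (ℝ × ℝ) p).symm) (chartAt (ℝ × ℝ) p p)
    have h1 := (smul_eq_zero.1 h0).resolve_left (by simp)
    -- Contraction with the position vector isolates the first factor of the wedge; its product with
    -- `coneD a` is $\varepsilon A\neq0$.
    have h2 : contr (wedge (coneD (ι p) (ε • a + b)) coneK) (coneEmb (ι p)) = 0 := by
      rw [h1]; ext i; simp [contr]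
    rw [contr_wedge, ip5_coneK_coneEmb, ip5_coneD_coneEmb, zero_smul, sub_zero] at h2
    have h3 : ip5 ((-1 : ℝ) • coneD (ι p) (ε • a + b)) (coneD (ι p) a) = 0 := by
      rw [h2]; simp [ip5]
    rw [ip5_smul_left, ip5_coneD_coneD, ip3_add_left, ip3_smul_left, ip3_comm b a, hw.ab] at h3
    have hε0 : ε ≠ 0 := by
      rintro rfl
      simp at hε
    have := mul_ne_zero hε0 hw.hA
    apply this
    linarith

end IsMinimalSurface

end Surface

/-! ### Comparison of null directions in coordinates -/

section Plane

variable {o ε : ℝ} {f n : ℝ × ℝ → E31} {w : ℝ × ℝ}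

lemma IsMinimalNear.ip3_fderiv_n_parJ (h : IsMinimalNear o f n w) (X : ℝ × ℝ) :
    ip3 (fderiv ℝ n w X) (fderiv ℝ n w (parJ X)) = 0 := by
  obtain ⟨hu, hv⟩ := h.pd_n rfl rfl rfl
  have hw := h.frame.self_of_nhds
  rw [fderiv_parJ_eq_pd, fderiv_eq_pd n, hu, hv]
  simp only [ip3_add_left, ip3_add_right, ip3_smul_left,
    ip3_smul_right, hw.bb, hw.ab, ip3_comm (pd 1 f w) (pd 0 f w)]
  ring

lemma IsMinimalNear.ip3_n_fderiv_n (h : IsMinimalNear o f n w) (X : ℝ × ℝ) :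
    ip3 (n w) (fderiv ℝ n w X) = 0 := by
  obtain ⟨hu, hv⟩ := h.pd_n rfl rfl rfl
  have hw := h.frame.self_of_nhds
  rw [fderiv_eq_pd n, hu, hv]
  simp only [ip3_add_right, ip3_smul_right, hw.na, hw.nb]
  ring

/-- Comparison of the light-like tangent vectors that occur in the covariant derivative of the
twistor lift and in the nilpotent structure of the frame. -/
lemma IsMinimalNear.smul_lightlike_eq (h : IsMinimalNear o f n w) (hε : ε ^ 2 = 1) {A l m r σ : ℝ}
    (hA : A = ip3 (pd 0 f w) (pd 0 f w)) (hl : l = ip3 (pd 0 (pd 0 f) w) (n w))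
    (hm : m = ip3 (pd 0 (pd 1 f) w) (n w)) (hr : r ^ 2 * (l ^ 2 - m ^ 2) = σ * A) (hσ : σ ^ 2 = 1)
    (Y : ℝ × ℝ) :
    (-σ * (ε * (l * A / (√2 * (l ^ 2 - m ^ 2))) + m * A / (√2 * (l ^ 2 - m ^ 2))) *
      ip3 (r • pd 0 n w - (ε * r) • pd 1 n w) (fderiv ℝ n w Y) * √2) •
      (r • pd 0 n w - (ε * r) • pd 1 n w) = (Y.1 + ε * Y.2) • (ε • pd 0 f w + pd 1 f w) := by
  obtain ⟨hu, hv⟩ := h.pd_n hA hl hm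
  have hw := h.frame.self_of_nhds
  rw [← hA] at hw
  have hA0 := hw.hA
  have hD : l ^ 2 - m ^ 2 ≠ 0 := by
    intro h0
    rw [h0, mul_zero] at hr
    rcases mul_eq_zero.1 hr.symm with h1 | h1
    · simp [h1] at hσ
    · exact hA0 h1
  have h1 : ip3 (r • pd 0 n w - (ε * r) • pd 1 n w) (fderiv ℝ n w Y) =
      r * (Y.1 + ε * Y.2) * ((l ^ 2 - m ^ 2) / A) := by
    rw [fderiv_eq_pd n, sub_eq_add_neg, ← neg_smul, hu, hv]
    simp only [ip3_add_left, ip3_add_right, ip3_smul_left, ip3_smul_right, hw.bb, hw.ab,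
      ip3_comm (pd 1 f w) (pd 0 f w), ← hA]
    field_simp
    ring
  -- As $dn$ anticommutes with $j$, it sends the null direction $(1,-\varepsilon)$ into the line of
  -- $f_u+\varepsilon f_v$.
  have h2 : r • pd 0 n w - (ε * r) • pd 1 n w =
      (r / A * (ε * m - l)) • (pd 0 f w + ε • pd 1 f w) := by
    rw [hu, hv]
    match_scalars
    · field_simp
      ring
    · field_simp
      linear_combination -m * r * hε
  have h3 : ε • pd 0 f w + pd 1 f w = ε • (pd 0 f w + ε • pd 1 f w) := by
    rw [smul_add, smul_smul, ← sq, hε, one_smul]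
  rw [h1, h2, h3, smul_smul, smul_smul]
  congr 1
  have h4 : σ * r ^ 2 * (l ^ 2 - m ^ 2) = A := by
    linear_combination σ * hr + A * hσ
  -- The coefficient $\varepsilon l+m$ is the factor complementary to the one in $\xi_1$, which
  -- explains the denominators of $\tilde l,\tilde m$.
  have h5 : (ε * l + m) * (ε * m - l) = -ε * (l ^ 2 - m ^ 2) := by
    linear_combination l * m * hε
  have h6 : √2 ≠ 0 := by simp
  have h7 : -σ * (ε * (l * A / (√2 * (l ^ 2 - m ^ 2))) + m * A / (√2 * (l ^ 2 - m ^ 2))) *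
      (r * (Y.1 + ε * Y.2) * ((l ^ 2 - m ^ 2) / A)) * √2 * (r / A * (ε * m - l)) =
      -(σ * r ^ 2 / A) * ((ε * l + m) * (ε * m - l)) * (Y.1 + ε * Y.2) := by
    generalize l ^ 2 - m ^ 2 = D at *
    field_simp
  rw [h7, h5]
  have h8 : -(σ * r ^ 2 / A) * (-ε * (l ^ 2 - m ^ 2)) = ε * ((σ * r ^ 2 * (l ^ 2 - m ^ 2)) / A) := by
    ring
  rw [h8, h4, div_self hA0]
  ring

end Plane

/-! ### The explicit frame and the covariant derivative of $J_\varepsilon$ -/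

section Surface

variable {M : Type*} [TopologicalSpace M] [ChartedSpace (ℝ × ℝ) M]
  {ι n : M → E31} {o ε : ℝ} {φ : OpenPartialHomeomorph M (ℝ × ℝ)} {p : M}

/-- The factor that normalizes the derivatives of the conformal Gauss map. -/
def frameScale (ι : M → E31) (φ : OpenPartialHomeomorph M (ℝ × ℝ)) (p : M) : ℝ :=
  1 / (√|gaussCurv ι p| * Real.exp (confFactor ι φ p))

omit [ChartedSpace (ℝ × ℝ) M] in
lemma exp_two_mul_confFactor (hA : 0 < inducedMetric ι φ 0 0 (φ p)) :
    Real.exp (2 * confFactor ι φ p) = inducedMetric ι φ 0 0 (φ p) := by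
  rw [confFactor, ← mul_assoc, mul_one_div_cancel two_ne_zero, one_mul, Real.exp_log hA]

lemma frameScale_sq (hA : 0 < inducedMetric ι φ 0 0 (φ p)) (hp : p ∈ Reg ι) :
    frameScale ι φ p ^ 2 * (|gaussCurv ι p| * inducedMetric ι φ 0 0 (φ p)) = 1 := by
  have h1 : Real.exp (confFactor ι φ p) ^ 2 = inducedMetric ι φ 0 0 (φ p) := by
    rw [← exp_two_mul_confFactor hA, two_mul, Real.exp_add, sq]
  have h2 : 0 < |gaussCurv ι p| := abs_pos.2 hp
  rw [frameScale, div_pow, mul_pow, Real.sq_sqrt (abs_nonneg _), h1]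
  field_simp

/-- The first vector of the frame in coordinates. -/
def frameDir (ι : M → E31) (p : M) : ℝ × ℝ := if gaussCurv ι p < 0 then (1, 0) else (0, 1)

variable [HasGroupoid M paraholomorphicGroupoid]

namespace IsMinimalSurface

lemma exists_isAdaptedChart_of_pos (h : IsMinimalSurface o ι n)
    (hφ : φ ∈ paraholomorphicGroupoid.maximalAtlas M) (hp : p ∈ φ.source)
    (hA : 0 < inducedMetric ι φ 0 0 (φ p)) : ∃ ψ, IsAdaptedChart ι ψ ∧ p ∈ ψ.source := by
  have hs := (h.contDiffAt hφ hp).pd 0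
  have hcont : ContinuousAt (inducedMetric ι φ 0 0) (φ p) :=
    (isBilinearMap_ip3.contDiffAt hs hs).continuousAt
  have hev := (φ.continuousAt hp).eventually (hcont.eventually_const_lt hA)
  obtain ⟨s, hs1, hs2, hs3⟩ := mem_nhds_iff.1 hev
  refine ⟨φ.restr s, ⟨restr_mem_maximalAtlas _ hφ hs2, fun q hq => ?_⟩, ?_⟩
  · rw [OpenPartialHomeomorph.restr_source, hs2.interior_eq] at hq
    exact hs1 hq.2
  · rw [OpenPartialHomeomorph.restr_source, hs2.interior_eq]
    exact ⟨hp, hs3⟩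

lemma exists_isAdaptedChart (h : IsMinimalSurface o ι n) (p : M) :
    ∃ ψ, IsAdaptedChart ι ψ ∧ p ∈ ψ.source := by
  have hφ := paraholomorphicGroupoid.chart_mem_maximalAtlas (M := M) p
  have hc := mem_chart_source (ℝ × ℝ) p
  set φ := chartAt (ℝ × ℝ) p
  have hw := h.isConfFrame hφ hc
  rcases lt_or_gt_of_ne hw.hA with hneg | hpos
  · refine h.exists_isAdaptedChart_of_pos (swap_mem_maximalAtlas hφ) (p := p) (by simp [hc]) ?_
    have hpd : pd 0 ((ι ∘ φ.symm) ∘ parJ) (parJ (φ p)) = pd 1 (ι ∘ φ.symm) (φ p) := by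
      have hd := (h.contDiffAt hφ hc).differentiableAt_infty
      simp only [pd]
      rw [fderiv_comp _ (by exact hd) parJ.differentiableAt, parJ.fderiv]
      rfl
    change 0 < ip3 (pd 0 ((ι ∘ φ.symm) ∘ parJ) (parJ (φ p)))
      (pd 0 ((ι ∘ φ.symm) ∘ parJ) (parJ (φ p)))
    rw [hpd, hw.bb]
    linarith
  · exact h.exists_isAdaptedChart_of_pos hφ hc hpos

/-- In both curvature cases $e_3$ is the image of $j$ applied to the direction of $e_1$, so the case
distinction is confined to `frameDir`. -/
lemma gaussFrame_eq (h : IsMinimalSurface o ι n) {ν : M → E52} (hν : IsDualNormal ι n ν)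
    (hφ : φ ∈ paraholomorphicGroupoid.maximalAtlas M) (hp : p ∈ φ.source) (hreg : p ∈ Reg ι) :
    gaussFrame ι n ν φ p =
      ![coneD (ι p) (fderiv ℝ (n ∘ φ.symm) (φ p) (frameScale ι φ p • frameDir ι p)),
        (1 / √2) • (coneK - coneEmb (ι p)),
        coneD (ι p) (fderiv ℝ (n ∘ φ.symm) (φ p) (parJ (frameScale ι φ p • frameDir ι p))),
        (1 / √2) • (coneK + coneEmb (ι p))] := by
  have hpd : ∀ i, chartD φ i (conformalGaussMap ι n) p =
      coneD (ι p) (pd i (n ∘ φ.symm) (φ p)) := fun i => h.fderiv_gauss hφ hp _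
  rw [map_smul, map_smul, map_smul, coneD_smul, coneD_smul]
  simp only [gaussFrame, hpd, h.dualNormal_eq hν hreg]
  by_cases hK : gaussCurv ι p < 0
  · simp only [hK, if_true, frameDir]
    rfl
  · simp only [hK, if_false, frameDir]
    rfl

/-- The third fundamental form is $-K^M$ times the first, so the space-like direction for $F$ is $u$
if $K^M<0$ and $v$ if $K^M>0$. -/
lemma isConfFrame_frame (h : IsMinimalSurface o ι n)
    (hφ : φ ∈ paraholomorphicGroupoid.maximalAtlas M) (hp : p ∈ φ.source)
    (hA : 0 < inducedMetric ι φ 0 0 (φ p)) (hreg : p ∈ Reg ι) :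
    IsConfFrame (-o) 1 (fderiv ℝ (n ∘ φ.symm) (φ p) (frameScale ι φ p • frameDir ι p))
      (fderiv ℝ (n ∘ φ.symm) (φ p) (parJ (frameScale ι φ p • frameDir ι p))) (n p) := by
  have hm := h.isMinimalNear hφ hp
  have hw := h.isConfFrame hφ hp
  have hK := h.gaussCurv_eq hφ hp
  have hform : ∀ X, ip3 (fderiv ℝ (n ∘ φ.symm) (φ p) X) (fderiv ℝ (n ∘ φ.symm) (φ p) X) =
      -gaussCurv ι p * (inducedMetric ι φ 0 0 (φ p) * (X.1 ^ 2 - X.2 ^ 2)) := by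
    intro X
    have h1 := hm.ip3_fderiv_n X
    simp only [Function.comp_apply, φ.left_inv hp] at h1
    have h2 : ip3 (fderiv ℝ (ι ∘ φ.symm) (φ p) X) (fderiv ℝ (ι ∘ φ.symm) (φ p) X) =
        inducedMetric ι φ 0 0 (φ p) * (X.1 ^ 2 - X.2 ^ 2) := by
      rw [fderiv_eq_pd]
      simp only [ip3_add_left, ip3_add_right, ip3_smul_left, ip3_smul_right, hw.bb, hw.ab,
        ip3_comm (pd 1 (ι ∘ φ.symm) (φ p)) (pd 0 (ι ∘ φ.symm) (φ p)), inducedMetric]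
      ring
    rw [h1, h2, hK, neg_neg]
    rfl
  have hr := frameScale_sq hA hreg
  set X := frameScale ι φ p • frameDir ι p with hX
  have hXX : -gaussCurv ι p * (inducedMetric ι φ 0 0 (φ p) * (X.1 ^ 2 - X.2 ^ 2)) = 1 := by
    rw [← hr]
    by_cases hneg : gaussCurv ι p < 0
    · simp [hX, frameDir, hneg, abs_of_neg hneg]; ring
    · simp [hX, frameDir, hneg, abs_of_nonneg (not_lt.1 hneg)]; ring
  have haa : ip3 (fderiv ℝ (n ∘ φ.symm) (φ p) X) (fderiv ℝ (n ∘ φ.symm) (φ p) X) = 1 := by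
    rw [hform, hXX]
  have hn : ∀ Y, ip3 (n p) (fderiv ℝ (n ∘ φ.symm) (φ p) Y) = 0 := by
    intro Y
    have := hm.ip3_n_fderiv_n Y
    rwa [Function.comp_apply, φ.left_inv hp] at this
  refine ⟨by simpa using h.ho, one_ne_zero, haa, ?_, hm.ip3_fderiv_n_parJ X, h.normal.unit p,
    hn _, hn _, ?_⟩
  · rw [hform, ← hXX]
    change -gaussCurv ι p * (_ * (X.2 ^ 2 - X.1 ^ 2)) = _
    ring
  · rw [← ip3_lcross, hm.lcross_fderiv_n, haa, Function.comp_apply, φ.left_inv hp, ip3_smul_left,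
      h.normal.unit]
    ring

lemma isAdaptedFrame_gaussFrame (h : IsMinimalSurface o ι n) {ν : M → E52}
    (hν : IsDualNormal ι n ν) (hφ : IsAdaptedChart ι φ) (hp : p ∈ φ.source) (hreg : p ∈ Reg ι) :
    IsAdaptedFrame o (conformalGaussMap ι n) p (gaussFrame ι n ν φ p) := by
  rw [h.gaussFrame_eq hν hφ.1 hp hreg]
  refine ⟨?_, ?_⟩
  · rw [conformalGaussMap_eq]
    exact (h.isConfFrame_frame hφ.1 hp (hφ.2 p hp) hreg).isOrientedFrame
  · obtain ⟨X, hX⟩ := coordD_surjective hφ.1 hp (frameScale ι φ p • frameDir ι p)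
    refine ⟨X, ?_, ?_⟩
    · rw [h.dAt_gauss, h.dAt_normal hφ.1 hp, hX]
      rfl
    · rw [h.dAt_gauss, h.dAt_normal hφ.1 hp, coordD_parJ hφ.1 hp, hX]
      rfl

lemma eventuallyEq_of_isTwistorLift (h : IsMinimalSurface o ι n) {Ω : M → Biv}
    (hΩ : IsTwistorLift o (conformalGaussMap ι n) (Reg ι) ε Ω) (hp : p ∈ Reg ι) :
    Ω =ᶠ[𝓝 p] fun q => gaussTwistor o ε (ι q) (n q) := by
  filter_upwards [h.reg_mem_nhds hp] with q hq
  obtain ⟨e, he, hΩe⟩ := hΩ q hq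
  rw [hΩe, h.Omega2_eq he]

/-- Here $\xi_2=\sqrt2$ `coneK`, so both sides are wedges with `coneK` and only the first factors
have to be compared. -/
lemma smul_wedge_eq (h : IsMinimalSurface o ι n) (hε : ε ^ 2 = 1) {ν : M → E52}
    (hν : IsDualNormal ι n ν) (hφ : IsAdaptedChart ι φ) (hp : p ∈ φ.source) (hreg : p ∈ Reg ι)
    (X : ℝ × ℝ) :
    ((if gaussCurv ι p < 0 then -1 else 1) * (ε * lTilde ι n φ p + mTilde ι n φ p) *
      theta1 ε (gaussFrame ι n ν φ p) (dAt (conformalGaussMap ι n) p X)) •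
      wedge (xi1 ε (gaussFrame ι n ν φ p)) (xi2 (gaussFrame ι n ν φ p)) =
    ((coordD φ p X).1 + ε * (coordD φ p X).2) •
      wedge (coneD (ι p) (ε • pd 0 (ι ∘ φ.symm) (φ p) + pd 1 (ι ∘ φ.symm) (φ p))) coneK := by
  have hA := hφ.2 p hp
  have hm := h.isMinimalNear hφ.1 hp
  have hK := h.gaussCurv_eq hφ.1 hp
  have hr := frameScale_sq hA hreg
  set r := frameScale ι φ p
  set A := inducedMetric ι φ 0 0 (φ p) with hAdef
  set l := secondFF ι n φ 0 0 p with hl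
  set m := secondFF ι n φ 0 1 p with hmdef
  have key : ∀ σ, r ^ 2 * (l ^ 2 - m ^ 2) = σ * A → σ ^ 2 = 1 → _ := fun σ h1 h2 =>
    hm.smul_lightlike_eq hε (A := A) (l := l) (m := m) (r := r) (σ := σ) rfl
      (by rw [Function.comp_apply, φ.left_inv hp]; rfl)
      (by rw [Function.comp_apply, φ.left_inv hp]; rfl) h1 h2 (coordD φ p X)
  set u := pd 0 (n ∘ φ.symm) (φ p) with hu
  set v := pd 1 (n ∘ φ.symm) (φ p) with hv
  have hxi2 : xi2 (gaussFrame ι n ν φ p) = √2 • coneK := by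
    rw [h.gaussFrame_eq hν hφ.1 hp hreg]
    simp only [xi2, Matrix.cons_val]
    have h2 : (√2 : ℝ) = 2 * (1 / √2) := by
      field_simp
      rw [Real.sq_sqrt]; norm_num
    conv_rhs => rw [h2]
    module
  rw [theta1_apply, hxi2, h.dAt_gauss, h.dAt_normal hφ.1 hp, wedge_smul_right, smul_smul,
    ← wedge_smul_left, ← wedge_smul_left, ← coneD_smul]
  congr 1
  rw [lTilde, mTilde, exp_two_mul_confFactor hA]
  simp only [← hl, ← hmdef, ← hAdef]
  -- For $K^M>0$ the roles of $u,v$ are exchanged, which multiplies $\xi_1$ by $-\varepsilon$. The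
  -- factor occurs twice, in $\theta^1$ and in $\xi_1$, and its square is $1$.
  have hxi1 : xi1 ε (gaussFrame ι n ν φ p) = coneD (ι p)
      ((if gaussCurv ι p < 0 then 1 else -ε) • (r • u - (ε * r) • v)) := by
    rw [h.gaussFrame_eq hν hφ.1 hp hreg]
    simp only [xi1, Matrix.cons_val]
    rw [fderiv_parJ_eq_pd, fderiv_eq_pd, ← hu, ← hv, sub_eq_add_neg, ← neg_smul, ← coneD_smul, ← coneD_add]
    congr 1
    by_cases hneg : gaussCurv ι p < 0
    · simp only [frameDir, hneg, if_true]
      simp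
      module
    · simp only [frameDir, hneg, if_false]
      rw [smul_sub, smul_smul, smul_smul, show -ε * (ε * r) = -(ε ^ 2 * r) by ring, hε]
      simp
      module
  rw [hxi1, ip5_coneD_coneD]
  by_cases hneg : gaussCurv ι p < 0
  · simp only [hneg, if_true, one_smul]
    rw [abs_of_neg hneg, hK] at hr
    have hk := key 1 (by field_simp at hr; linarith) (by norm_num)
    rw [← hk, coneD_smul]
  · simp only [hneg, if_false]
    rw [abs_of_nonneg (not_lt.1 hneg), hK] at hr
    have hk := key (-1) (by field_simp at hr; linarith) (by norm_num)
    rw [← hk, ip3_smul_left, coneD_smul, coneD_smul, smul_smul]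
    congr 1
    linear_combination (ε * (l * A / (√2 * (l ^ 2 - m ^ 2))) + m * A / (√2 * (l ^ 2 - m ^ 2))) *
      ip3 (r • u - (ε * r) • v) (fderiv ℝ (n ∘ φ.symm) (φ p) (coordD φ p X)) * √2 * hε

lemma hasCovDerivEndAt (h : IsMinimalSurface o ι n) (hε : ε ^ 2 = 1) {ν : M → E52}
    (hν : IsDualNormal ι n ν) (hφ : IsAdaptedChart ι φ) (hp : p ∈ φ.source) (hreg : p ∈ Reg ι)
    {Ω : M → Biv} (hΩ : IsTwistorLift o (conformalGaussMap ι n) (Reg ι) ε Ω)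
    {J : M → E52 →ₗ[ℝ] E52}
    (hJ : IsCorrespondingPara o (conformalGaussMap ι n) (Reg ι) ε Ω J) :
    HasCovDerivEndAt (conformalGaussMap ι n) J p fun X y =>
      ((if gaussCurv ι p < 0 then -1 else 1) * (ε * lTilde ι n φ p + mTilde ι n φ p) *
        theta1 ε (gaussFrame ι n ν φ p) (dAt (conformalGaussMap ι n) p X)) •
        nilN ε (gaussFrame ι n ν φ p) y := by
  intro Y hY hYF X
  have hev := h.eventuallyEq_of_isTwistorLift hΩ hreg
  have hφ0 := paraholomorphicGroupoid.chart_mem_maximalAtlas (M := M) p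
  have hc := mem_chart_source (ℝ × ℝ) p
  obtain ⟨e, he, hΩe⟩ := hΩ p hreg
  have hd : DifferentiableAt ℝ (Ω ∘ (chartAt (ℝ × ℝ) p).symm) (chartAt (ℝ × ℝ) p p) := by
    have ht := (chartAt (ℝ × ℝ) p).symm.continuousAt ((chartAt (ℝ × ℝ) p).map_source hc)
    rw [ContinuousAt, (chartAt (ℝ × ℝ) p).left_inv hc] at ht
    exact (h.differentiableAt_gaussTwistor hφ0 hc).congr_of_eventuallyEq (ht.eventually hev)
  have hJ' : ∀ᶠ q in 𝓝 p, ∀ y, ip5 y (conformalGaussMap ι n q) = 0 →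
      J q y = (-√2) • contr (Ω q) y := by
    filter_upwards [h.reg_mem_nhds hreg] with q hq y hy
    obtain ⟨e', he', hΩe', hJe'⟩ := hJ q hq
    rw [he'.apply_of_isAdmissiblePara hJe' hy, hΩe']
  beta_reduce
  rw [covDeriv_end_eq (h.ip5_gauss p) he.1 hΩe hd hJ'
    (contDiffAt_comp_symm hφ0 hc hY).differentiableAt_infty hYF,
    h.nablaBiv_eq hε hφ.1 hp hev, nilN_apply]
  simp only [smul_neg, ← contr_smul_left]
  rw [h.smul_wedge_eq hε hν hφ hp hreg, smul_smul, contr_smul_left, contr_smul_left, ← neg_smul]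
  congr 1
  field_simp

end IsMinimalSurface

end Surface

end

/-- Contraction with a bivector as a linear map. -/
noncomputable def contrL (A : Biv) : E52 →ₗ[ℝ] E52 where
  toFun := contr A
  map_add' := contr_add_right A
  map_smul' c y := contr_smul_right c A y

theorem mainTheorem6 {M : Type*} [TopologicalSpace M] [ChartedSpace (ℝ × ℝ) M]
    [HasGroupoid M paraholomorphicGroupoid] (ι n : M → E31) (o : ℝ) (ho : o = 1 ∨ o = -1)
    (hι : IsTimelikeConformalImmersion ι) (hn : IsUnitNormal o ι n) (hmin : IsMinimal ι n)
    (ε : ℝ) (hε : ε = 1 ∨ ε = -1) :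
    (∃ (Ω : M → Biv) (J : M → E52 →ₗ[ℝ] E52),
      IsTwistorLift o (conformalGaussMap ι n) (Reg ι) ε Ω ∧
      IsCorrespondingPara o (conformalGaussMap ι n) (Reg ι) ε Ω J) ∧
    (∀ Ω : M → Biv, IsTwistorLift o (conformalGaussMap ι n) (Reg ι) ε Ω →
      (∀ p ∈ Reg ι, IsFullyLightlikeAt (conformalGaussMap ι n) Ω p) ∧
      ∀ J : M → E52 →ₗ[ℝ] E52,
        IsCorrespondingPara o (conformalGaussMap ι n) (Reg ι) ε Ω J →
        ∀ ν : M → E52, IsDualNormal ι n ν →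
        (∀ p ∈ Reg ι, ∃ φ, IsAdaptedChart ι φ ∧ p ∈ φ.source) ∧
        ∀ φ, IsAdaptedChart ι φ → ∀ p ∈ φ.source ∩ Reg ι, ∀ e, e = gaussFrame ι n ν φ p →
          IsAdaptedFrame o (conformalGaussMap ι n) p e ∧
          Ω p = Omega2 ε e ∧
          IsAdmissiblePara ε e (J p) ∧
          IsAdmissibleNil ε ![e 0, e 1, ε • e 2, ε • e 3] (nilN ε e) ∧
          (gaussCurv ι p < 0 →
            HasCovDerivEndAt (conformalGaussMap ι n) J p fun X y =>
              (-(ε * lTilde ι n φ p + mTilde ι n φ p) *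
                theta1 ε e (dAt (conformalGaussMap ι n) p X)) • nilN ε e y) ∧
          (0 < gaussCurv ι p →
            HasCovDerivEndAt (conformalGaussMap ι n) J p fun X y =>
              ((ε * lTilde ι n φ p + mTilde ι n φ p) *
                theta1 ε e (dAt (conformalGaussMap ι n) p X)) • nilN ε e y)) := by
  have h : IsMinimalSurface o ι n := ⟨by rcases ho with rfl | rfl <;> norm_num, hι, hn, hmin⟩
  have hε2 : ε ^ 2 = 1 := by rcases hε with rfl | rfl <;> norm_num
  have hlift : IsTwistorLift o (conformalGaussMap ι n) (Reg ι) ε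
      fun q => gaussTwistor o ε (ι q) (n q) := by
    intro p hp
    obtain ⟨φ, hφ, hpφ⟩ := h.exists_isAdaptedChart p
    have he := h.isAdaptedFrame_gaussFrame h.isDualNormal_coneK hφ hpφ hp
    exact ⟨_, he, (h.Omega2_eq he).symm⟩
  -- Existence: the explicit bivector is the lift, and its contraction scaled by $-\sqrt2$ is the
  -- corresponding structure.
  refine ⟨⟨_, fun q => (-√2) • contrL (gaussTwistor o ε (ι q) (n q)), hlift, fun p hp => ?_⟩,
    fun Ω hΩ => ⟨fun p hp => h.isFullyLightlikeAt hε2 (h.eventuallyEq_of_isTwistorLift hΩ hp),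
      fun J hJ ν hν => ⟨fun p _ => h.exists_isAdaptedChart p, ?_⟩⟩⟩
  · obtain ⟨e, he, hΩe⟩ := hlift p hp
    exact ⟨e, he.1, hΩe, he.1.isAdmissiblePara fun y _ => by rw [← hΩe]; rfl⟩
  · rintro φ hφ p ⟨hpφ, hp⟩ e rfl
    have he := h.isAdaptedFrame_gaussFrame hν hφ hpφ hp
    have hΩe : Ω p = Omega2 ε (gaussFrame ι n ν φ p) :=
      (h.eventuallyEq_of_isTwistorLift hΩ hp).self_of_nhds.trans (h.Omega2_eq he).symm
    have hcov := h.hasCovDerivEndAt hε2 hν hφ hpφ hp hΩ hJ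
    refine ⟨he, hΩe, he.1.isAdmissiblePara fun y hy => ?_, he.1.isAdmissibleNil hε2, ?_, ?_⟩
    · obtain ⟨e', he', hΩe', hJe'⟩ := hJ p hp
      rw [he'.apply_of_isAdmissiblePara hJe' hy, ← hΩe', hΩe]
    · intro hK
      simpa only [if_pos hK, neg_one_mul] using hcov
    · intro hK
      simpa only [if_neg hK.not_gt, one_mul] using hcov
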